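/- Let $R$ be a commutative noetherian local domain of Krull dimension $1$ with maximal ideal $\mathfrak m$ whose $\mathfrak m$-adic completion $\widehat R$ is reduced. Let $M$ be a finitely generated torsion-free $R$-module, and write $$\widehat M = M\otimes_R\widehat R \cong L_1^{n_1}\oplus\cdots\oplus L_s^{n_s},$$ where $L_1,\dots,L_s$ are pairwise non-isomorphic indecomposable $\widehat R$-modules and $n_i\ge 1$ for all $i$. Let $\mathbb N_0^*=\mathbb N_0\cup\{\infty\}$, with $0\cdot\infty=0$, $a\cdot\infty=\infty$ for $a\neq0$, and $a+\infty=\infty$. Let $V^*(M)$ be the set of isomorphism classes of countably generated $R$-modules that are isomorphic to direct summands of direct sums of copies of $M$. Put $S=\operatorname{End}_R(M)$ and $\widehat S=\operatorname{End}_{\widehat R}(\widehat M)$, with Jacobson radicals $J(S)$ and $J(\widehat S)$. For $i=1,\dots,s$ let $V_i$ be the simple right $S$-module $Q_i/Q_iJ(\widehat S)$, where $Q_i=\operatorname{Hom}_{\widehat R}(\widehat M,L_i)$ and $S$ acts through the canonical map $S\to\widehat S$; let $D_i=\operatorname{End}_S(V_i)$. Let $\mathbf D_M\colon V^*(M)\to(\mathbb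 N_0^*)^s$ be the map $$\mathbf D_M([X])=\bigl(\dim_{D_i}\operatorname{Hom}_S(V_i,\,P/PJ(S))\bigr)_{i=1,\dots,s},\qquad P=\operatorname{Hom}_R(M,X),$$ where every infinite dimension is recorded as $\infty$. Let $P_1,\dots,P_\ell$ be the minimal prime ideals of $\widehat R$ (so each $\widehat R_{P_j}$ is a field), and let $a_{ji}=\dim_{\widehat R_{P_j}}\bigl(L_i\otimes_{\widehat R}\widehat R_{P_j}\bigr)$. Then $\mathbf x=(x_1,\dots,x_s)\in(\mathbb N_0^*)^s$ lies in $\mathbf D_M(V^*(M))$ if and only if $$\sum_{i=1}^s a_{ji}x_i=\sum_{i=1}^s a_{ki}x_i\qquad\text{for all } j,k\in\{1,\dots,\ell\}.$$ -/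

import Mathlib

universe u v w

open scoped TensorProduct

noncomputable section

namespace LocalAdd

/-! ### Modules over a ring -/

/-- A module is indecomposable if it is nonzero and is not the direct sum of two nonzero
submodules. -/
def IsIndecomposable (A : Type u) (L : Type w) [Ring A] [AddCommGroup L] [Module A L] : Prop :=
  Nontrivial L ∧ ∀ p q : Submodule A L, IsCompl p q → p = ⊥ ∨ q = ⊥

/-- `X` has a countable generating set. -/
def IsCountablyGenerated (A : Type u) (X : Type v) [Ring A] [AddCommGroup X] [Module A X] : Prop :=
  ∃ t : Set X, t.Countable ∧ Submodule.span A t = ⊤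

/-- `X` belongs to `Add M`: it is isomorphic to a direct summand of a direct sum of copies
of `M`. -/
def InAdd (A : Type u) (M X : Type v) [Ring A] [AddCommGroup M] [Module A M]
    [AddCommGroup X] [Module A X] : Prop :=
  ∃ (ι : Type v) (e : X →ₗ[A] (ι →₀ M)) (p : (ι →₀ M) →ₗ[A] X), p ∘ₗ e = LinearMap.id

/-- Two countably generated modules in `Add M` are identified if they are isomorphic. -/
instance vStarSetoid (A : Type u) (M : Type v) [Ring A] [AddCommGroup M] [Module A M] :
    Setoid {X : ModuleCat.{v} A // IsCountablyGenerated A X ∧ InAdd A M X} where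
  r X Y := Nonempty (X.1 ≃ₗ[A] Y.1)
  iseqv :=
    ⟨fun _ => ⟨LinearEquiv.refl _ _⟩, fun ⟨e⟩ => ⟨e.symm⟩, fun ⟨e⟩ ⟨f⟩ => ⟨e.trans f⟩⟩

/-- `V*(M)`: the set of isomorphism classes of countably generated modules in `Add M`. -/
def VStar (A : Type u) (M : Type v) [Ring A] [AddCommGroup M] [Module A M] : Type _ :=
  Quotient (vStarSetoid A M)

/-! ### Radical factors of Hom modules

For a ring `S`, a right `S`-module is a module over the opposite ring `Sᵐᵒᵖ`. -/

/-- `Hom_A(N, X)`, regarded as a right module over `S = End_A(N)` by precomposition. -/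
def HomMod (A : Type u) (N : Type v) (X : Type w) [Ring A] [AddCommGroup N] [Module A N]
    [AddCommGroup X] [Module A X] : Type (max v w) :=
  N →ₗ[A] X

section

variable (A : Type u) (N : Type v) (X : Type w) [Ring A] [AddCommGroup N] [Module A N]
    [AddCommGroup X] [Module A X]

instance : AddCommGroup (HomMod A N X) :=
  inferInstanceAs (AddCommGroup (N →ₗ[A] X))

instance : Module (Module.End A N)ᵐᵒᵖ (HomMod A N X) where
  smul c f := LinearMap.comp (f : N →ₗ[A] X) (MulOpposite.unop c)
  one_smul f := LinearMap.comp_id (f : N →ₗ[A] X)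
  mul_smul _ _ _ := rfl
  smul_zero c := LinearMap.zero_comp (MulOpposite.unop c)
  smul_add c f g := LinearMap.add_comp (MulOpposite.unop c) (g : N →ₗ[A] X) f
  add_smul c d f := LinearMap.comp_add (MulOpposite.unop c) (MulOpposite.unop d) (f : N →ₗ[A] X)
  zero_smul f := LinearMap.comp_zero (f : N →ₗ[A] X)

end

/-- The right `S`-module `Q / Q J(S)`, where `S = End_A(N)`, `Q = Hom_A(N, X)` and `J(S)` is the
Jacobson radical of `S`. -/
abbrev HomTop (A : Type u) (N : Type v) (X : Type w) [Ring A] [AddCommGroup N] [Module A N]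
    [AddCommGroup X] [Module A X] : Type (max v w) :=
  HomMod A N X ⧸
    (Ring.jacobson (Module.End A N)ᵐᵒᵖ • (⊤ : Submodule (Module.End A N)ᵐᵒᵖ (HomMod A N X)))

/-- The dimension of `Hom_T(V, W)` over the endomorphism ring of `V` (which acts from the right,
by precomposition), with all infinite values identified with `⊤ = ∞`. -/
def homDim (T : Type u) (V : Type v) (W : Type w) [Ring T] [AddCommGroup V] [Module T V]
    [AddCommGroup W] [Module T W] : ℕ∞ :=
  Cardinal.toENat (Module.rank (Module.End T V)ᵐᵒᵖ (HomMod T V W))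

/-! ### Completion of a local ring -/

/-- The completion of a local ring with respect to its maximal ideal. -/
abbrev RHat (R : Type u) [CommRing R] [IsLocalRing R] : Type u :=
  AdicCompletion (IsLocalRing.maximalIdeal R) R

/-- The extension of scalars of `M` to the completion of `R`. -/
abbrev MHat (R : Type u) (M : Type v) [CommRing R] [IsLocalRing R] [AddCommGroup M]
    [Module R M] : Type (max u v) :=
  RHat R ⊗[R] M

/-- The ring homomorphism from the opposite ring of `S = End_R(M)` to the opposite ring of
the endomorphism ring of the completion of `M`, sending `f` to `id ⊗ f`. -/
def endToCompl (R : Type u) (M : Type v) [CommRing R] [IsLocalRing R] [AddCommGroup M]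
    [Module R M] :
    (Module.End R M)ᵐᵒᵖ →+* (Module.End (RHat R) (MHat R M))ᵐᵒᵖ :=
  RingHom.op (Module.End.baseChangeHom R (RHat R) M).toRingHom

/-- The right `S`-module `V` attached to a direct summand `L` of the completion of `M`: the
radical factor `Q / Q J(Ŝ)` of the right `Ŝ`-module `Q = Hom(M̂, L)`, where `Ŝ = End(M̂)`,
with scalars restricted along `S → Ŝ`. -/
def SimpleMod (R : Type u) (M : Type v) (L : Type w) [CommRing R] [IsLocalRing R]
    [AddCommGroup M] [Module R M] [AddCommGroup L] [Module (RHat R) L] : Type (max u v w) :=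
  HomTop (RHat R) (MHat R M) L

section

variable (R : Type u) (M : Type v) (L : Type w) [CommRing R] [IsLocalRing R]
    [AddCommGroup M] [Module R M] [AddCommGroup L] [Module (RHat R) L]

instance : AddCommGroup (SimpleMod R M L) :=
  inferInstanceAs (AddCommGroup (HomTop (RHat R) (MHat R M) L))

instance : Module (Module.End R M)ᵐᵒᵖ (SimpleMod R M L) :=
  Module.compHom (HomTop (RHat R) (MHat R M) L) (endToCompl R M)

end

/-- The `i`-th entry is `dim_{D_i} Hom_S(V_i, Q / Q J(S))`, where `S = End_R(M)`,
`Q = Hom_R(M, X)`, `V_i` is the simple right `S`-module attached to `L i`, and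
`D_i = End_S(V_i)`. -/
def dimVec (R : Type u) (M : Type v) {s : ℕ} (L : Fin s → Type w) [CommRing R] [IsLocalRing R]
    [AddCommGroup M] [Module R M] [∀ i, AddCommGroup (L i)] [∀ i, Module (RHat R) (L i)]
    (X : Type v) [AddCommGroup X] [Module R X] : Fin s → ℕ∞ :=
  fun i => homDim (Module.End R M)ᵐᵒᵖ (SimpleMod R M (L i)) (HomTop R M X)

/-! ### Invariance under isomorphism -/

/-- Composition with an isomorphism, as an isomorphism of right `End_A(N)`-modules. -/
def homModCongr (A : Type u) (N : Type v) {X Y : Type w} [Ring A] [AddCommGroup N] [Module A N]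
    [AddCommGroup X] [Module A X] [AddCommGroup Y] [Module A Y] (e : X ≃ₗ[A] Y) :
    HomMod A N X ≃ₗ[(Module.End A N)ᵐᵒᵖ] HomMod A N Y where
  toFun f := e.toLinearMap ∘ₗ (f : N →ₗ[A] X)
  invFun f := e.symm.toLinearMap ∘ₗ (f : N →ₗ[A] Y)
  map_add' f g := LinearMap.comp_add (f : N →ₗ[A] X) g e.toLinearMap
  map_smul' _ _ := rfl
  left_inv f := LinearMap.ext fun m => e.symm_apply_apply (show X from DFunLike.coe (F := N →ₗ[A] X) f m)
  right_inv f := LinearMap.ext fun m => e.apply_symm_apply (show Y from DFunLike.coe (F := N →ₗ[A] Y) f m)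

theorem homDim_congr (T : Type u) (V : Type v) {W W' : Type w} [Ring T] [AddCommGroup V]
    [Module T V] [AddCommGroup W] [Module T W] [AddCommGroup W'] [Module T W'] (e : W ≃ₗ[T] W') :
    homDim T V W = homDim T V W' := by
  unfold homDim
  rw [(homModCongr T V e).rank_eq]

theorem nonempty_homTop_congr (A : Type u) (N : Type v) {X Y : Type w} [Ring A]
    [AddCommGroup N] [Module A N] [AddCommGroup X] [Module A X] [AddCommGroup Y] [Module A Y]
    (e : X ≃ₗ[A] Y) : Nonempty (HomTop A N X ≃ₗ[(Module.End A N)ᵐᵒᵖ] HomTop A N Y) := by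
  refine ⟨Submodule.Quotient.equiv _ _ (homModCongr A N e) ?_⟩
  rw [Submodule.map_smul'', Submodule.map_top]
  congr 1
  exact LinearEquiv.range _

/-- The map `D_M : V*(M) → (ℕ ∪ {∞})^s` sending the class of `X` to the dimension vector of
the right `S`-module `Hom_R(M, X)`. -/
def DMap (R : Type u) (M : Type v) {s : ℕ} (L : Fin s → Type w) [CommRing R] [IsLocalRing R]
    [AddCommGroup M] [Module R M] [∀ i, AddCommGroup (L i)] [∀ i, Module (RHat R) (L i)] :
    VStar R M → Fin s → ℕ∞ :=
  Quotient.lift (fun X => dimVec R M L X.1) (by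
    rintro X Y ⟨e⟩
    obtain ⟨E⟩ := nonempty_homTop_congr R M e
    exact funext fun i => homDim_congr _ _ E)

/-- The rank of `L` at the prime `P`: the dimension of `L ⊗ A_P` over `A_P`. -/
def rankAt {A : Type u} [CommRing A] (P : Ideal A) [P.IsPrime] (L : Type w) [AddCommGroup L]
    [Module A L] : ℕ :=
  Module.finrank (Localization.AtPrime P) (Localization.AtPrime P ⊗[A] L)

end LocalAdd

end

/-!
Modulo the radical, `Hom(M, -)` does not change under completion: as `dim R = 1`, the quotient of
`R` by a nonzero element is already complete, so the image of `End M` is dense in `End M̂` modulo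
the radical. Hence `D_M(X)` counts how often each `Lᵢ` occurs in the top of `Hom(M̂, X̂)`, which
looks like the top of `Hom(M̂, ⨁ Lᵢ^(xᵢ))`.

Necessity: an isomorphism of tops lifts, on finitely generated pieces, to maps in both directions
that remain injective after any base change, so `X̂` and `⨁ Lᵢ^(xᵢ)` have the same rank at every
minimal prime; the rank of `X̂` at a minimal prime is the rank of `X`.

Sufficiency: if `N = ⨁ Lᵢ^(xᵢ)` has constant rank, choose a family `v` in `N` that is a basis at
every minimal prime. The elements having a nonzero multiple in the `R`-span of `v` form an
`R`-module `X` with `X̂ = N`. Approximating the splittings of finite pieces of `N` by `R`-linear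
maps exhibits `X` as a direct summand of a direct sum of copies of `M`.
-/

noncomputable section

namespace LocalAdd

universe w'

/-! ### The Jacobson radical through units -/

theorem exists_mul_eq_one_of_sub_one_mem_jacobson {A : Type*} [Ring A] {x : A}
    (hx : x - 1 ∈ Ring.jacobson A) : ∃ z, z * x = 1 := by
  rw [← Ideal.jacobson_bot] at hx
  obtain ⟨z, hz⟩ := Ideal.exists_mul_sub_mem_of_sub_one_mem_jacobson x hx
  exact ⟨z, sub_eq_zero.mp hz⟩

theorem isUnit_of_sub_one_mem_jacobson {A : Type*} [Ring A] {x : A}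
    (hx : x - 1 ∈ Ring.jacobson A) : IsUnit x := by
  obtain ⟨z, hzx⟩ := exists_mul_eq_one_of_sub_one_mem_jacobson hx
  have hz : z - 1 ∈ Ring.jacobson A := by
    have h : z - 1 = -(z * (x - 1)) := by rw [mul_sub, hzx, mul_one, neg_sub]
    rw [h]
    exact neg_mem (Ideal.mul_mem_left _ z hx)
  obtain ⟨t, htz⟩ := exists_mul_eq_one_of_sub_one_mem_jacobson hz
  exact ⟨⟨x, z, left_inv_eq_right_inv htz hzx ▸ htz, hzx⟩, rfl⟩

theorem mem_jacobson_iff_isUnit {A : Type*} [Ring A] {x : A} :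
    x ∈ Ring.jacobson A ↔ ∀ y, IsUnit (1 + y * x) := by
  refine ⟨fun hx y => isUnit_of_sub_one_mem_jacobson ?_, fun h => ?_⟩
  · rw [add_sub_cancel_left]
    exact Ideal.mul_mem_left _ y hx
  · rw [← Ideal.jacobson_bot, Ideal.mem_jacobson_iff]
    intro y
    obtain ⟨z, hz⟩ := (h y).exists_left_inv
    refine ⟨z, Submodule.mem_bot A |>.mpr ?_⟩
    rw [sub_eq_zero, ← hz, mul_add, mul_one, mul_assoc, add_comm]

theorem isUnit_one_add_mul_comm {A : Type*} [Ring A] {x y : A} (h : IsUnit (1 + x * y)) :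
    IsUnit (1 + y * x) := by
  obtain ⟨z, hr, hl⟩ := isUnit_iff_exists.mp h
  refine isUnit_iff_exists.mpr ⟨1 - y * z * x, ?_, ?_⟩
  · calc (1 + y * x) * (1 - y * z * x) = 1 + y * x - y * ((1 + x * y) * z) * x := by noncomm_ring
      _ = 1 := by rw [hr]; noncomm_ring
  · calc (1 - y * z * x) * (1 + y * x) = 1 + y * x - y * (z * (1 + x * y)) * x := by noncomm_ring
      _ = 1 := by rw [hl]; noncomm_ring

theorem op_mem_jacobson_iff {A : Type*} [Ring A] {x : A} :
    MulOpposite.op x ∈ Ring.jacobson Aᵐᵒᵖ ↔ x ∈ Ring.jacobson A := by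
  have hop (y : A) : IsUnit (1 + MulOpposite.op y * MulOpposite.op x) ↔ IsUnit (1 + x * y) := by
    rw [← MulOpposite.op_mul, ← MulOpposite.op_one, ← MulOpposite.op_add, isUnit_op]
  simp only [mem_jacobson_iff_isUnit, MulOpposite.op_surjective.forall, hop]
  exact forall_congr' fun y => ⟨isUnit_one_add_mul_comm, isUnit_one_add_mul_comm⟩

theorem eq_zero_of_eq_sum_smul_of_mem_jacobson {A E : Type*} [Ring A] [AddCommGroup E]
    [Module A E] {κ : Type*} [Fintype κ] {α : κ → κ → A} (hα : ∀ i j, α i j ∈ Ring.jacobson A)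
    {y : κ → E} (hy : ∀ i, y i = ∑ j, α i j • y j) (i : κ) : y i = 0 := by
  have hfg : (Submodule.span A (Set.range y)).FG := Submodule.fg_span (Set.finite_range y)
  have hbot := hfg.eq_bot_of_le_jacobson_smul <| by
    rw [Submodule.span_le]
    rintro _ ⟨i, rfl⟩
    rw [hy i]
    exact Submodule.sum_mem _ fun j _ =>
      Submodule.smul_mem_smul (hα i j) (Submodule.subset_span ⟨j, rfl⟩)
  exact (Submodule.mem_bot A).mp (hbot ▸ Submodule.subset_span ⟨i, rfl⟩)

theorem isUnit_one_add_comp_comm {A X Y : Type*} [Ring A] [AddCommGroup X] [Module A X]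
    [AddCommGroup Y] [Module A Y] {f : X →ₗ[A] Y} {g : Y →ₗ[A] X}
    (h : IsUnit (1 + f ∘ₗ g : Module.End A Y)) : IsUnit (1 + g ∘ₗ f : Module.End A X) := by
  obtain ⟨z, hr, hl⟩ := isUnit_iff_exists.mp h
  refine isUnit_iff_exists.mpr ⟨1 - g ∘ₗ z ∘ₗ f, ?_, ?_⟩
  · ext x
    have hfx := congrArg g (LinearMap.congr_fun hr (f x))
    simp only [Module.End.mul_apply, LinearMap.add_apply, Module.End.one_apply,
      LinearMap.comp_apply, LinearMap.sub_apply, map_add, map_sub] at hfx ⊢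
    rw [← sub_eq_zero] at hfx
    rw [← sub_eq_zero, ← neg_eq_zero, ← hfx]
    abel
  · ext x
    have hfx := congrArg g (LinearMap.congr_fun hl (f x))
    simp only [Module.End.mul_apply, LinearMap.add_apply, Module.End.one_apply,
      LinearMap.comp_apply, LinearMap.sub_apply, map_add] at hfx ⊢
    rw [← sub_eq_zero] at hfx
    rw [← sub_eq_zero, ← neg_eq_zero, ← hfx]
    abel

/-! ### Retracts -/

/-- `X` is a retract of `Q`, that is, isomorphic to a direct summand of `Q`. -/
def IsRetract (A X Q : Type*) [Ring A] [AddCommGroup X] [Module A X] [AddCommGroup Q]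
    [Module A Q] : Prop :=
  ∃ (e : X →ₗ[A] Q) (p : Q →ₗ[A] X), p ∘ₗ e = LinearMap.id

namespace IsRetract

variable {A X Y Q : Type*} [Ring A] [AddCommGroup X] [Module A X] [AddCommGroup Y] [Module A Y]
  [AddCommGroup Q] [Module A Q]

theorem of_linearEquiv (e : X ≃ₗ[A] Q) : IsRetract A X Q :=
  ⟨e, e.symm, LinearMap.ext e.symm_apply_apply⟩

theorem trans (hXY : IsRetract A X Y) (hYQ : IsRetract A Y Q) : IsRetract A X Q := by
  obtain ⟨e, p, hpe⟩ := hXY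
  obtain ⟨f, q, hqf⟩ := hYQ
  refine ⟨f ∘ₗ e, p ∘ₗ q, LinearMap.ext fun x => ?_⟩
  exact (congrArg p (LinearMap.congr_fun hqf (e x))).trans (LinearMap.congr_fun hpe x)

theorem finite [Module.Finite A Q] (h : IsRetract A X Q) : Module.Finite A X := by
  obtain ⟨e, p, hpe⟩ := h
  exact .of_surjective p fun x => ⟨e x, LinearMap.congr_fun hpe x⟩

theorem dfinsupp {Λ : Type*} {Z : Λ → Type*} [∀ a, AddCommGroup (Z a)] [∀ a, Module A (Z a)]
    (h : ∀ a, IsRetract A (Z a) Q) : IsRetract A (Π₀ a, Z a) (Π₀ _ : Λ, Q) := by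
  choose e p hpe using h
  refine ⟨DFinsupp.mapRange.linearMap e, DFinsupp.mapRange.linearMap p, LinearMap.ext fun x => ?_⟩
  ext a
  simpa using LinearMap.congr_fun (hpe a) (x a)

theorem dfinsupp_single {ι : Type*} {Z : ι → Type*} [∀ a, AddCommGroup (Z a)]
    [∀ a, Module A (Z a)] (i : ι) : IsRetract A (Z i) (Π₀ i, Z i) := by
  classical
  exact ⟨DFinsupp.lsingle i, DFinsupp.lapply i, LinearMap.ext fun x => by simp⟩

end IsRetract

/-! ### Finitely supported families -/

theorem comp_sum {A X Y Z κ : Type*} [Ring A] [AddCommGroup X] [Module A X] [AddCommGroup Y]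
    [Module A Y] [AddCommGroup Z] [Module A Z] (g : Y →ₗ[A] Z) (F : Finset κ)
    (f : κ → X →ₗ[A] Y) : g ∘ₗ ∑ k ∈ F, f k = ∑ k ∈ F, g ∘ₗ f k :=
  LinearMap.ext fun x => by
    simp only [LinearMap.comp_apply, LinearMap.sum_apply, map_sum]

theorem nonempty_linearEquiv_dfinsupp {A ι G : Type*} {Y : ι → Type*} [Ring A]
    [∀ a, AddCommGroup (Y a)] [∀ a, Module A (Y a)] [AddCommGroup G] [Module A G]
    (i : ∀ a, Y a →ₗ[A] G) (p : ∀ a, G →ₗ[A] Y a) (hpi : ∀ a, p a ∘ₗ i a = LinearMap.id)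
    (hpi' : ∀ a b, a ≠ b → p b ∘ₗ i a = 0) (htop : ⨆ a, LinearMap.range (i a) = ⊤) :
    Nonempty (G ≃ₗ[A] Π₀ a, Y a) := by
  classical
  have hp (b : ι) : p b ∘ₗ DFinsupp.lsum ℕ i = DFinsupp.lapply b := by
    refine DFinsupp.lhom_ext' fun a => ?_
    rw [LinearMap.comp_assoc]
    rcases eq_or_ne a b with rfl | hab
    · ext y
      simpa using LinearMap.congr_fun (hpi a) y
    · ext y
      simpa [DFinsupp.single_eq_of_ne hab.symm] using LinearMap.congr_fun (hpi' a b hab) y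
  refine ⟨(LinearEquiv.ofBijective (DFinsupp.lsum ℕ i) ⟨?_, ?_⟩).symm⟩
  · rw [injective_iff_map_eq_zero]
    intro y hy
    ext b
    simpa [hy] using (LinearMap.congr_fun (hp b) y).symm
  · rw [← LinearMap.range_eq_top, eq_top_iff, ← htop, iSup_le_iff]
    rintro a _ ⟨y, rfl⟩
    exact ⟨DFinsupp.single a y, DFinsupp.lsum_single ..⟩

section DFinsupp

variable {ι : Type*} [DecidableEq ι]

theorem exists_finset_forall_sum_single_eq {Y : ι → Type*} [∀ i, AddCommGroup (Y i)]
    (S : Finset (Π₀ i, Y i)) :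
    ∃ F : Finset ι, ∀ y ∈ S, ∑ i ∈ F, (DFinsupp.single i (y i) : Π₀ i, Y i) = y := by
  classical
  refine ⟨S.biUnion DFinsupp.support, fun y hy => ?_⟩
  refine Eq.trans (Finset.sum_subset (Finset.subset_biUnion_of_mem DFinsupp.support hy)
    fun i _ hi => ?_).symm (DFinsupp.sum_single (f := y))
  rw [DFinsupp.notMem_support_iff.mp hi, DFinsupp.single_zero]

variable {A : Type*} [Ring A] {Y : ι → Type*} [∀ i, AddCommGroup (Y i)] [∀ i, Module A (Y i)]

theorem exists_finset_eq_sum_lsingle_comp {Q : Type*} [AddCommGroup Q] [Module A Q]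
    [Module.Finite A Q] (g : Q →ₗ[A] Π₀ i, Y i) :
    ∃ F : Finset ι, g = ∑ i ∈ F, DFinsupp.lsingle i ∘ₗ DFinsupp.lapply i ∘ₗ g := by
  classical
  obtain ⟨S, hS⟩ := Module.Finite.fg_top (R := A) (M := Q)
  obtain ⟨F, hF⟩ := exists_finset_forall_sum_single_eq (S.image g)
  refine ⟨F, LinearMap.ext_on hS fun x hx => ?_⟩
  rw [LinearMap.sum_apply]
  exact (hF (g x) (Finset.mem_image_of_mem g hx)).symm

end DFinsupp

/-! ### Radical factors of modules of homomorphisms -/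

section HomTop

variable {A : Type*} [Ring A] {Q X Y Z : Type*} [AddCommGroup Q] [Module A Q]
  [AddCommGroup X] [Module A X] [AddCommGroup Y] [Module A Y] [AddCommGroup Z] [Module A Z]

variable (A Q) in
/-- Postcomposition with `f`, as a homomorphism of right `End_A(Q)`-modules. -/
def homModMap (f : X →ₗ[A] Y) : HomMod A Q X →ₗ[(Module.End A Q)ᵐᵒᵖ] HomMod A Q Y where
  toFun g := f ∘ₗ (g : Q →ₗ[A] X)
  map_add' g h := LinearMap.comp_add (g : Q →ₗ[A] X) h f
  map_smul' _ _ := rfl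

variable (A Q X) in
/-- The class of a homomorphism `Q → X` in the radical factor of `Hom_A(Q, X)`. -/
def homTopMk : (Q →ₗ[A] X) →+ HomTop A Q X :=
  (Submodule.mkQ (Ring.jacobson (Module.End A Q)ᵐᵒᵖ •
    (⊤ : Submodule (Module.End A Q)ᵐᵒᵖ (HomMod A Q X)))).toAddMonoidHom

variable (A Q) in
/-- The homomorphism of radical factors induced by postcomposition with `f`. -/
def homTopMap (f : X →ₗ[A] Y) : HomTop A Q X →ₗ[(Module.End A Q)ᵐᵒᵖ] HomTop A Q Y :=
  Submodule.mapQ _ _ (homModMap A Q f) <| by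
    rw [← Submodule.map_le_iff_le_comap, Submodule.map_smul'']
    exact smul_mono_right _ le_top

theorem homTopMk_surjective : Function.Surjective (homTopMk A Q X) :=
  Submodule.mkQ_surjective (Ring.jacobson (Module.End A Q)ᵐᵒᵖ •
    (⊤ : Submodule (Module.End A Q)ᵐᵒᵖ (HomMod A Q X)))

theorem op_smul_homTopMk (s : Module.End A Q) (h : Q →ₗ[A] X) :
    MulOpposite.op s • homTopMk A Q X h = homTopMk A Q X (h ∘ₗ s) := rfl

theorem homTopMap_homTopMk (f : X →ₗ[A] Y) (h : Q →ₗ[A] X) :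
    homTopMap A Q f (homTopMk A Q X h) = homTopMk A Q Y (f ∘ₗ h) := rfl

theorem homTopMap_ext {F G : HomTop A Q X →ₗ[(Module.End A Q)ᵐᵒᵖ] HomTop A Q Y}
    (h : ∀ k : Q →ₗ[A] X, F (homTopMk A Q X k) = G (homTopMk A Q X k)) : F = G :=
  LinearMap.ext <| homTopMk_surjective.forall.mpr h

theorem homTopMap_comp (g : Y →ₗ[A] Z) (f : X →ₗ[A] Y) :
    homTopMap A Q (g ∘ₗ f) = homTopMap A Q g ∘ₗ homTopMap A Q f :=
  homTopMap_ext fun _ => rfl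

theorem homTopMap_id : homTopMap A Q (LinearMap.id : X →ₗ[A] X) = LinearMap.id :=
  homTopMap_ext fun _ => rfl

/-- The isomorphism between radical factors induced by an isomorphism of modules. -/
def homTopCongr (e : X ≃ₗ[A] Y) : HomTop A Q X ≃ₗ[(Module.End A Q)ᵐᵒᵖ] HomTop A Q Y :=
  .ofLinearMap (homTopMap A Q e.toLinearMap) (homTopMap A Q e.symm.toLinearMap)
    (by rw [← homTopMap_comp, e.comp_symm, homTopMap_id])
    (by rw [← homTopMap_comp, e.symm_comp, homTopMap_id])

theorem homTopMap_zero : homTopMap A Q (0 : X →ₗ[A] Y) = 0 :=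
  homTopMap_ext fun k => by
    rw [homTopMap_homTopMk, LinearMap.zero_comp, map_zero, LinearMap.zero_apply]

theorem homTopMk_comp_eq_zero {s : Module.End A Q} (hs : s ∈ Ring.jacobson (Module.End A Q))
    (h : Q →ₗ[A] X) : homTopMk A Q X (h ∘ₗ s) = 0 :=
  (Submodule.Quotient.mk_eq_zero _).mpr <|
    Submodule.smul_mem_smul (op_mem_jacobson_iff.mpr hs)
      (Submodule.mem_top (M := HomMod A Q X) (x := h))

theorem comp_mem_jacobson_of_homTopMk_eq_zero {k : Q →ₗ[A] X} (hk : homTopMk A Q X k = 0)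
    (q : X →ₗ[A] Q) : q ∘ₗ k ∈ Ring.jacobson (Module.End A Q) := by
  let φ : HomMod A Q X →ₗ[(Module.End A Q)ᵐᵒᵖ] (Module.End A Q)ᵐᵒᵖ :=
    { toFun g := MulOpposite.op (q ∘ₗ (g : Q →ₗ[A] X))
      map_add' g h := congrArg MulOpposite.op (LinearMap.comp_add (g : Q →ₗ[A] X) h q)
      map_smul' _ _ := rfl }
  have hle : Ring.jacobson (Module.End A Q)ᵐᵒᵖ • ⊤ ≤
      Submodule.comap φ (Ring.jacobson (Module.End A Q)ᵐᵒᵖ) :=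
    Submodule.smul_le.mpr fun s hs g _ => by
      rw [Submodule.mem_comap, map_smul]
      exact Ideal.mul_mem_right _ _ hs
  exact op_mem_jacobson_iff.mp (hle ((Submodule.Quotient.mk_eq_zero _).mp hk))

/-! ### Radical factors of retracts with local endomorphism ring -/

theorem homTopMk_ne_zero_iff [IsLocalRing (Module.End A X)] (hX : IsRetract A X Q)
    {h : Q →ₗ[A] X} :
    homTopMk A Q X h ≠ 0 ↔ ∃ q : X →ₗ[A] Q, h ∘ₗ q = LinearMap.id := by
  refine ⟨fun hne => ?_, fun ⟨q, hq⟩ h0 => ?_⟩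
  · contrapose! hne
    have hnonunit (q : X →ₗ[A] Q) : ¬ IsUnit (h ∘ₗ q : Module.End A X) := fun hu => by
      obtain ⟨z, hz⟩ := hu.exists_right_inv
      exact hne (q ∘ₗ z) hz
    obtain ⟨σ, τ, hτσ⟩ := hX
    have hmem : σ ∘ₗ h ∈ Ring.jacobson (Module.End A Q) := by
      refine mem_jacobson_iff_isUnit.mpr fun y => isUnit_one_add_comp_comm (g := y ∘ₗ σ) ?_
      exact (IsLocalRing.isUnit_or_isUnit_of_add_one (by abel)).resolve_right
        (mt (IsUnit.neg_iff _).mp (hnonunit (y ∘ₗ σ)))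
    rw [← LinearMap.id_comp h, ← hτσ, LinearMap.comp_assoc]
    exact homTopMk_comp_eq_zero hmem τ
  · have hu := mem_jacobson_iff_isUnit.mp (comp_mem_jacobson_of_homTopMk_eq_zero h0 q) (-1)
    have hu' : IsUnit (1 + h ∘ₗ (-q) : Module.End A X) :=
      isUnit_one_add_comp_comm (by rwa [neg_one_mul, ← LinearMap.neg_comp] at hu)
    rw [LinearMap.comp_neg, hq] at hu'
    exact not_isUnit_zero ((add_neg_cancel (1 : Module.End A X)) ▸ hu')

theorem isSimpleModule_homTop [IsLocalRing (Module.End A X)] (hX : IsRetract A X Q) :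
    IsSimpleModule (Module.End A Q)ᵐᵒᵖ (HomTop A Q X) := by
  rw [isSimpleModule_iff_toSpanSingleton_surjective]
  constructor
  · obtain ⟨σ, τ, hτσ⟩ := hX
    exact ⟨⟨_, 0, (homTopMk_ne_zero_iff ⟨σ, τ, hτσ⟩).mpr ⟨σ, hτσ⟩⟩⟩
  · refine homTopMk_surjective.forall.mpr fun h hne => homTopMk_surjective.forall.mpr fun k => ?_
    obtain ⟨q, hq⟩ := (homTopMk_ne_zero_iff hX).mp hne
    refine ⟨MulOpposite.op (q ∘ₗ k), ?_⟩
    rw [LinearMap.toSpanSingleton_apply, op_smul_homTopMk, ← LinearMap.comp_assoc, hq,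
      LinearMap.id_comp]

theorem isUnit_of_homTopMap_eq_id [IsLocalRing (Module.End A X)] (hX : IsRetract A X Q)
    {u : Module.End A X} (hu : homTopMap A Q u = LinearMap.id) : IsUnit u := by
  refine (IsLocalRing.isUnit_or_isUnit_of_add_one (add_sub_cancel u 1)).resolve_right fun hv => ?_
  obtain ⟨z, hz⟩ := hv.exists_right_inv
  obtain ⟨σ, τ, hτσ⟩ := hX
  refine (homTopMk_ne_zero_iff ⟨σ, τ, hτσ⟩).mpr ⟨σ, hτσ⟩ ?_
  calc homTopMk A Q X τ = homTopMk A Q X (((1 - u) * z) ∘ₗ τ) := by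
        rw [hz, Module.End.one_eq_id, LinearMap.id_comp]
    _ = homTopMk A Q X (z ∘ₗ τ) - homTopMap A Q u (homTopMk A Q X (z ∘ₗ τ)) := by
        rw [homTopMap_homTopMk, ← map_sub, Module.End.mul_eq_comp, LinearMap.comp_assoc,
          LinearMap.sub_comp, Module.End.one_eq_id, LinearMap.id_comp]
    _ = 0 := by rw [hu, LinearMap.id_apply, sub_self]

theorem exists_homTopMap_eq [Module.Finite A Q] {ι : Type*}
    (hX : IsRetract A X (Π₀ _ : ι, Q))
    (θ : HomTop A Q X →ₗ[(Module.End A Q)ᵐᵒᵖ] HomTop A Q Y) :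
    ∃ f : X →ₗ[A] Y, homTopMap A Q f = θ := by
  classical
  obtain ⟨e, p, hpe⟩ := hX
  let i (t : ι) : Q →ₗ[A] Π₀ _ : ι, Q := DFinsupp.lsingle (M := fun _ => Q) t
  choose f hf using fun t => homTopMk_surjective (θ (homTopMk A Q X (p ∘ₗ i t)))
  refine ⟨DFinsupp.lsum ℕ f ∘ₗ e, homTopMap_ext fun h => ?_⟩
  let c (t : ι) : Module.End A Q := DFinsupp.lapply t ∘ₗ e ∘ₗ h
  obtain ⟨F, hF⟩ : ∃ F : Finset ι, e ∘ₗ h = ∑ t ∈ F, i t ∘ₗ c t :=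
    exists_finset_eq_sum_lsingle_comp (e ∘ₗ h)
  have h_eq : h = ∑ t ∈ F, (p ∘ₗ i t) ∘ₗ c t := by
    simpa only [← LinearMap.comp_assoc, hpe, LinearMap.id_comp, comp_sum]
      using congrArg (fun g => p ∘ₗ g) hF
  have hf_eq : (DFinsupp.lsum ℕ f ∘ₗ e) ∘ₗ h = ∑ t ∈ F, f t ∘ₗ c t := by
    rw [LinearMap.comp_assoc, hF, comp_sum]
    exact Finset.sum_congr rfl fun t _ => LinearMap.ext fun x =>
      DFinsupp.lsum_single ℕ f t (c t x)
  calc homTopMap A Q (DFinsupp.lsum ℕ f ∘ₗ e) (homTopMk A Q X h)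
      = ∑ t ∈ F, MulOpposite.op (c t) • homTopMk A Q Y (f t) := by
        rw [homTopMap_homTopMk, hf_eq, map_sum]
        rfl
    _ = θ (homTopMk A Q X (∑ t ∈ F, (p ∘ₗ i t) ∘ₗ c t)) := by
        rw [map_sum, map_sum]
        exact Finset.sum_congr rfl fun t _ => by rw [hf, ← map_smul, op_smul_homTopMk]
    _ = θ (homTopMk A Q X h) := by rw [← h_eq]

theorem nonempty_linearEquiv_of_homTop [Module.Finite A Q] [IsLocalRing (Module.End A X)]
    [IsLocalRing (Module.End A Y)] (hX : IsRetract A X Q) (hY : IsRetract A Y Q)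
    (θ : HomTop A Q X ≃ₗ[(Module.End A Q)ᵐᵒᵖ] HomTop A Q Y) : Nonempty (X ≃ₗ[A] Y) := by
  have hcopies : IsRetract A Q (Π₀ _ : Unit, Q) := .dfinsupp_single (Z := fun _ => Q) ()
  obtain ⟨f, hf⟩ := exists_homTopMap_eq (hX.trans hcopies) θ.toLinearMap
  obtain ⟨g, hg⟩ := exists_homTopMap_eq (hY.trans hcopies) θ.symm.toLinearMap
  have hgf : IsUnit (g ∘ₗ f : Module.End A X) :=
    isUnit_of_homTopMap_eq_id hX (by rw [homTopMap_comp, hf, hg, LinearEquiv.symm_comp])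
  have hfg : IsUnit (f ∘ₗ g : Module.End A Y) :=
    isUnit_of_homTopMap_eq_id hY (by rw [homTopMap_comp, hf, hg, LinearEquiv.comp_symm])
  rw [Module.End.isUnit_iff] at hgf hfg
  exact ⟨.ofBijective f ⟨.of_comp (f := g) hgf.1, .of_comp (g := g) hfg.2⟩⟩

end HomTop

/-! ### Radical factors of direct sums -/

section DirectSum

variable {A : Type*} [Ring A] {Q : Type*} [AddCommGroup Q] [Module A Q] {Λ : Type*}
  {Y : Λ → Type*} [∀ a, AddCommGroup (Y a)] [∀ a, Module A (Y a)]

theorem nonempty_homMod_dfinsupp [Module.Finite A Q] :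
    Nonempty (HomMod A Q (Π₀ a, Y a) ≃ₗ[(Module.End A Q)ᵐᵒᵖ] Π₀ a, HomMod A Q (Y a)) := by
  classical
  refine nonempty_linearEquiv_dfinsupp (fun a => homModMap A Q (DFinsupp.lsingle (M := Y) a))
    (fun a => homModMap A Q (DFinsupp.lapply (M := Y) a)) (fun a => ?_) (fun a b hab => ?_) ?_
  · exact LinearMap.ext fun h => congrArg (fun k => homModMap A Q k h)
      (DFinsupp.lapply_comp_lsingle_same a)
  · exact LinearMap.ext fun h => (congrArg (fun k => homModMap A Q k h)
      (DFinsupp.lapply_comp_lsingle_of_ne b a hab.symm)).trans (LinearMap.zero_comp _)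
  · rw [eq_top_iff]
    intro h _
    obtain ⟨F, hF⟩ := exists_finset_eq_sum_lsingle_comp (h : Q →ₗ[A] Π₀ a, Y a)
    rw [show h = _ from hF]
    exact Submodule.sum_mem _ fun t _ => Submodule.mem_iSup_of_mem t ⟨_, rfl⟩

theorem nonempty_homTop_dfinsupp [Module.Finite A Q] :
    Nonempty (HomTop A Q (Π₀ a, Y a) ≃ₗ[(Module.End A Q)ᵐᵒᵖ] Π₀ a, HomTop A Q (Y a)) := by
  classical
  refine nonempty_linearEquiv_dfinsupp (fun a => homTopMap A Q (DFinsupp.lsingle a))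
    (fun a => homTopMap A Q (DFinsupp.lapply a)) (fun a => ?_) (fun a b hab => ?_) ?_
  · rw [← homTopMap_comp, DFinsupp.lapply_comp_lsingle_same, homTopMap_id]
  · rw [← homTopMap_comp, DFinsupp.lapply_comp_lsingle_of_ne _ _ hab.symm, homTopMap_zero]
  · rw [eq_top_iff]
    refine homTopMk_surjective.forall.mpr fun h _ => ?_
    obtain ⟨F, hF⟩ := exists_finset_eq_sum_lsingle_comp h
    rw [hF, map_sum]
    exact Submodule.sum_mem _ fun t _ => Submodule.mem_iSup_of_mem t
      ⟨homTopMk A Q (Y t) (DFinsupp.lapply t ∘ₗ h), rfl⟩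

theorem exists_homTop_linearEquiv_dfinsupp {I : Type*} {L : I → Type*}
    [∀ i, AddCommGroup (L i)] [∀ i, Module A (L i)]
    (hsimple : ∀ i, IsSimpleModule (Module.End A Q)ᵐᵒᵖ (HomTop A Q (L i)))
    {κ : Type*} [Fintype κ] (col : κ → I) (σ : ∀ k, L (col k) →ₗ[A] Q)
    (τ : ∀ k, Q →ₗ[A] L (col k)) (hστ : ∑ k, σ k ∘ₗ τ k = LinearMap.id)
    (X : Type*) [AddCommGroup X] [Module A X] :
    ∃ (S : Set (Submodule (Module.End A Q)ᵐᵒᵖ (HomTop A Q X))) (c : S → I),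
      Nonempty (HomTop A Q X ≃ₗ[(Module.End A Q)ᵐᵒᵖ] Π₀ a, HomTop A Q (L (c a))) := by
  let p (f : Σ i, L i →ₗ[A] X) : Submodule (Module.End A Q)ᵐᵒᵖ (HomTop A Q X) :=
    LinearMap.range (homTopMap A Q f.2)
  have hp : ⨆ f, p f = ⊤ := by
    rw [eq_top_iff]
    refine homTopMk_surjective.forall.mpr fun h _ => ?_
    rw [← LinearMap.comp_id h, ← hστ, comp_sum, map_sum]
    exact Submodule.sum_mem _ fun k _ => Submodule.mem_iSup_of_mem (p := p)
      ⟨col k, h ∘ₗ σ k⟩ ⟨homTopMk A Q _ (τ k), rfl⟩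
  have : IsSemisimpleModule (Module.End A Q)ᵐᵒᵖ (HomTop A Q X) :=
    isSemisimpleModule_of_isSemisimpleModule_submodule' (fun _ => .range _) hp
  obtain ⟨S, e, -, hS⟩ := IsSemisimpleModule.exists_linearEquiv_dfinsupp
    (Module.End A Q)ᵐᵒᵖ (HomTop A Q X)
  have hc (m : S) : ∃ i, Nonempty (m.1 ≃ₗ[(Module.End A Q)ᵐᵒᵖ] HomTop A Q (L i)) := by
    classical
    have := hS m
    by_contra! hcon
    have hle (f) : p f ≤ LinearMap.ker (DFinsupp.lapply m ∘ₗ e.toLinearMap) := by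
      rintro _ ⟨y, rfl⟩
      exact LinearMap.congr_fun ((LinearMap.bijective_or_eq_zero ((DFinsupp.lapply m ∘ₗ
        e.toLinearMap) ∘ₗ homTopMap A Q f.2)).resolve_left fun hb =>
          (hcon f.1).false (LinearEquiv.ofBijective _ hb).symm) y
    obtain ⟨x, hx⟩ := @exists_ne m.1 (IsSimpleModule.nontrivial (Module.End A Q)ᵐᵒᵖ m.1) 0
    have hx0 := iSup_le hle (hp ▸ Submodule.mem_top (x := e.symm (DFinsupp.single m x)))
    exact hx (by simpa using hx0)
  choose c hc using hc
  exact ⟨S, c, ⟨e.trans (DFinsupp.mapRange.linearEquiv fun m => (hc m).some)⟩⟩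

end DirectSum

/-! ### Multiplicities in semisimple modules -/

section HomDim

variable {T V W : Type*} [Ring T] [AddCommGroup V] [Module T V] [AddCommGroup W] [Module T W]

theorem nonempty_basis_homMod [IsSimpleModule T V] [IsSimpleModule T W] :
    Nonempty (Module.Basis (PLift (Nonempty (V ≃ₗ[T] W))) (Module.End T V)ᵐᵒᵖ
      (HomMod T V W)) := by
  by_cases h : Nonempty (V ≃ₗ[T] W)
  · obtain ⟨φ⟩ := id h
    have : Unique (PLift (Nonempty (V ≃ₗ[T] W))) := ⟨⟨⟨h⟩⟩, fun _ => rfl⟩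
    let E : (Module.End T V)ᵐᵒᵖ ≃ₗ[(Module.End T V)ᵐᵒᵖ] HomMod T V W :=
      .ofBijective (LinearMap.toSpanSingleton _ (HomMod T V W) φ.toLinearMap)
        ⟨fun c d hcd => MulOpposite.unop_injective <| LinearMap.ext fun x =>
          φ.injective (LinearMap.congr_fun (show φ.toLinearMap ∘ₗ c.unop = φ ∘ₗ d.unop from hcd) x),
        fun f => ⟨MulOpposite.op (φ.symm.toLinearMap ∘ₗ (f : V →ₗ[T] W)),
          LinearMap.ext fun x => φ.apply_symm_apply (DFunLike.coe (F := V →ₗ[T] W) f x)⟩⟩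
    exact ⟨(Module.Basis.singleton _ _).map E⟩
  · have : IsEmpty (PLift (Nonempty (V ≃ₗ[T] W))) := ⟨fun e => h e.down⟩
    have : Subsingleton (HomMod T V W) := subsingleton_of_forall_eq 0 fun f =>
      (LinearMap.bijective_or_eq_zero (f : V →ₗ[T] W)).resolve_left
        fun hf => h ⟨.ofBijective (f : V →ₗ[T] W) hf⟩
    exact ⟨.empty _⟩

theorem homDim_eq_of_linearEquiv_dfinsupp [IsSimpleModule T V] {Λ : Type*} {S : Λ → Type*}
    [∀ a, AddCommGroup (S a)] [∀ a, Module T (S a)] [∀ a, IsSimpleModule T (S a)]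
    (e : W ≃ₗ[T] Π₀ a, S a) :
    homDim T V W = Cardinal.toENat (Cardinal.mk {a // Nonempty (V ≃ₗ[T] S a)}) := by
  classical
  let _ := Module.End.instDivisionRing (R := T) (M := V)
  obtain ⟨E⟩ := nonempty_homMod_dfinsupp (A := T) (Q := V) (Y := S)
  let e' : HomMod T V W ≃ₗ[(Module.End T V)ᵐᵒᵖ] HomMod T V (Π₀ a, S a) :=
    .ofLinearMap (homModMap T V e) (homModMap T V e.symm)
      (LinearMap.ext fun f => LinearMap.ext fun x => e.apply_symm_apply _)
      (LinearMap.ext fun f => LinearMap.ext fun x => e.symm_apply_apply _)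
  let b := (DFinsupp.basis fun a => (nonempty_basis_homMod (T := T) (V := V) (W := S a)).some).map
    (e'.trans E).symm |>.reindex (Equiv.sigmaPLiftEquivSubtype _)
  simpa only [homDim, Cardinal.toENat_lift] using (congrArg Cardinal.toENat b.mk_eq_rank).symm

end HomDim

/-! ### Pure embeddings from isomorphisms of radical factors -/

section LTensor

variable {B : Type*} [CommRing B] {Q X Y F : Type*} [AddCommGroup Q] [Module B Q]
  [AddCommGroup X] [Module B X] [AddCommGroup Y] [Module B Y] [AddCommGroup F] [Module B F]
  {ι : Type*}

theorem IsRetract.exists_sum_lTensor_eq (hX : IsRetract B X (Π₀ _ : ι, Q)) (z : F ⊗[B] X) :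
    ∃ (κ : Finset ι) (u : κ → Q →ₗ[B] X) (v : κ → X →ₗ[B] Q),
      ∑ t, (u t).lTensor F ((v t).lTensor F z) = z := by
  classical
  obtain ⟨e, p, hpe⟩ := hX
  obtain ⟨S, hS⟩ := TensorProduct.exists_finset z
  obtain ⟨κ, hκ⟩ := exists_finset_forall_sum_single_eq (S.image fun a => e a.2)
  refine ⟨κ, fun t => p ∘ₗ DFinsupp.lsingle (M := fun _ => Q) t.1,
    fun t => DFinsupp.lapply t.1 ∘ₗ e, ?_⟩
  have hx (a) (ha : a ∈ S) :
      ∑ t : κ, p (DFinsupp.single t.1 (e a.2 t.1) : Π₀ _ : ι, Q) = a.2 := by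
    rw [← map_sum, Finset.sum_coe_sort κ fun t => (DFinsupp.single t (e a.2 t) : Π₀ _ : ι, Q),
      hκ _ (Finset.mem_image_of_mem _ ha)]
    exact LinearMap.congr_fun hpe a.2
  rw [hS]
  simp only [map_sum, LinearMap.lTensor_tmul]
  rw [Finset.sum_comm]
  refine Finset.sum_congr rfl fun a ha => ?_
  rw [← TensorProduct.tmul_sum]
  exact congrArg (a.1 ⊗ₜ[B] ·) (hx a ha)

theorem lTensor_injective_of_homTopMap_comp_eq_id (hX : IsRetract B X (Π₀ _ : ι, Q))
    {f : X →ₗ[B] Y} {g : Y →ₗ[B] X} (hgf : homTopMap B Q (g ∘ₗ f) = LinearMap.id) :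
    Function.Injective (f.lTensor F) := by
  rw [injective_iff_map_eq_zero]
  intro z hz
  obtain ⟨κ, u, v, huv⟩ := hX.exists_sum_lTensor_eq z
  let δ : X →ₗ[B] X := LinearMap.id - g ∘ₗ f
  have hδz : δ.lTensor F z = z := by
    rw [LinearMap.lTensor_sub, LinearMap.sub_apply, LinearMap.lTensor_comp,
      LinearMap.comp_apply, hz, map_zero, sub_zero, LinearMap.lTensor_id, LinearMap.id_apply]
  have hδ (h : Q →ₗ[B] X) : homTopMk B Q X (δ ∘ₗ h) = 0 := by
    rw [LinearMap.sub_comp, LinearMap.id_comp, map_sub, ← homTopMap_homTopMk (g ∘ₗ f), hgf,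
      LinearMap.id_apply, sub_self]
  let _ : Module (Module.End B Q) (F ⊗[B] Q) :=
    Module.compHom _ (Module.End.lTensorAlgHom B Q F).toRingHom
  have hsmul (s : Module.End B Q) (y : F ⊗[B] Q) : s • y = s.lTensor F y := rfl
  have hv := eq_zero_of_eq_sum_smul_of_mem_jacobson (A := Module.End B Q)
    (α := fun d c => v d ∘ₗ δ ∘ₗ u c) (y := fun c => (v c).lTensor F z)
    (fun d c => comp_mem_jacobson_of_homTopMk_eq_zero (hδ (u c)) (v d)) fun d => by
      conv_lhs => rw [← hδz, ← huv]
      simp only [hsmul, map_sum, LinearMap.lTensor_comp, LinearMap.comp_apply]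
  rw [← huv]
  exact Finset.sum_eq_zero fun t _ => by rw [hv t, map_zero]

theorem exists_forall_lTensor_injective [Module.Finite B Q] {κ : Type*}
    (hX : IsRetract B X (Π₀ _ : ι, Q)) (hY : IsRetract B Y (Π₀ _ : κ, Q))
    (θ : HomTop B Q X ≃ₗ[(Module.End B Q)ᵐᵒᵖ] HomTop B Q Y) :
    ∃ f : X →ₗ[B] Y, ∀ (F : Type w) [AddCommGroup F] [Module B F],
      Function.Injective (f.lTensor F) := by
  obtain ⟨f, hf⟩ := exists_homTopMap_eq hX θ.toLinearMap
  obtain ⟨g, hg⟩ := exists_homTopMap_eq hY θ.symm.toLinearMap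
  refine ⟨f, fun F _ _ => lTensor_injective_of_homTopMap_comp_eq_id hX (g := g) ?_⟩
  rw [homTopMap_comp, hf, hg, LinearEquiv.symm_comp]

end LTensor

/-! ### Restriction of scalars to the endomorphism ring of a module over a local ring -/

theorem smul_homTop_eq_zero {A Q X : Type*} [Ring A] [AddCommGroup Q] [Module A Q]
    [AddCommGroup X] [Module A X] {c : (Module.End A Q)ᵐᵒᵖ}
    (hc : c ∈ Ring.jacobson (Module.End A Q)ᵐᵒᵖ) (x : HomTop A Q X) : c • x = 0 := by
  obtain ⟨h, rfl⟩ := homTopMk_surjective x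
  exact homTopMk_comp_eq_zero (op_mem_jacobson_iff.mp hc) h

section SimpleMod

variable {R : Type u} {M : Type v} [CommRing R] [IsLocalRing R] [AddCommGroup M] [Module R M]
  {X Y : Type*} [AddCommGroup X] [Module (RHat R) X] [AddCommGroup Y] [Module (RHat R) Y]

variable (R M) in
/-- Every endomorphism of the completion of `M` is congruent modulo the Jacobson radical to one
induced by an endomorphism of `M`. -/
def EndDense : Prop :=
  ∀ s : (Module.End (RHat R) (MHat R M))ᵐᵒᵖ, ∃ t : (Module.End R M)ᵐᵒᵖ,
    s - endToCompl R M t ∈ Ring.jacobson (Module.End (RHat R) (MHat R M))ᵐᵒᵖ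

variable (R M X) in
/-- The identity map from the radical factor over the completion to its restriction of scalars. -/
def toSimpleMod : HomTop (RHat R) (MHat R M) X ≃+ SimpleMod R M X :=
  AddEquiv.refl _

theorem smul_toSimpleMod (t : (Module.End R M)ᵐᵒᵖ) (x : HomTop (RHat R) (MHat R M) X) :
    t • toSimpleMod R M X x = toSimpleMod R M X (endToCompl R M t • x) := rfl

theorem EndDense.exists_smul_eq (hd : EndDense R M) (s : (Module.End (RHat R) (MHat R M))ᵐᵒᵖ) :
    ∃ t : (Module.End R M)ᵐᵒᵖ, ∀ {X : Type w} [AddCommGroup X] [Module (RHat R) X]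
      (x : HomTop (RHat R) (MHat R M) X),
      t • toSimpleMod R M X x = toSimpleMod R M X (s • x) := by
  obtain ⟨t, ht⟩ := hd s
  refine ⟨t, fun x => ?_⟩
  have h := smul_homTop_eq_zero ht x
  rw [sub_smul, sub_eq_zero] at h
  rw [smul_toSimpleMod, h]

theorem EndDense.isSimpleModule_simpleMod (hd : EndDense R M)
    (h : IsSimpleModule (Module.End (RHat R) (MHat R M))ᵐᵒᵖ (HomTop (RHat R) (MHat R M) X)) :
    IsSimpleModule (Module.End R M)ᵐᵒᵖ (SimpleMod R M X) := by
  rw [isSimpleModule_iff_toSpanSingleton_surjective] at h ⊢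
  refine ⟨h.1, fun x hx y => ?_⟩
  obtain ⟨s, hs⟩ := h.2 ((toSimpleMod R M X).symm x) hx ((toSimpleMod R M X).symm y)
  obtain ⟨t, ht⟩ := hd.exists_smul_eq s
  exact ⟨t, (ht ((toSimpleMod R M X).symm x)).trans hs⟩

theorem EndDense.nonempty_homTop_equiv {X Y : Type w} [AddCommGroup X] [Module (RHat R) X]
    [AddCommGroup Y] [Module (RHat R) Y] (hd : EndDense R M)
    (θ : SimpleMod R M X ≃ₗ[(Module.End R M)ᵐᵒᵖ] SimpleMod R M Y) :
    Nonempty (HomTop (RHat R) (MHat R M) X ≃ₗ[(Module.End (RHat R) (MHat R M))ᵐᵒᵖ]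
      HomTop (RHat R) (MHat R M) Y) := by
  refine ⟨{ (toSimpleMod R M X).trans (θ.toAddEquiv.trans (toSimpleMod R M Y).symm) with
    map_smul' := fun s x => ?_ }⟩
  obtain ⟨t, ht⟩ := hd.exists_smul_eq s
  exact (congrArg θ (ht x)).symm.trans ((θ.map_smul t _).trans (ht _))

/-- An isomorphism from a radical factor over the completion to a direct sum of radical factors,
after restriction of scalars to the endomorphism ring of `M`. -/
def simpleModDFinsupp {Λ : Type*} {Z : Λ → Type*} [∀ a, AddCommGroup (Z a)]
    [∀ a, Module (RHat R) (Z a)]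
    (θ : HomTop (RHat R) (MHat R M) X ≃ₗ[(Module.End (RHat R) (MHat R M))ᵐᵒᵖ]
      Π₀ a, HomTop (RHat R) (MHat R M) (Z a)) :
    SimpleMod R M X ≃ₗ[(Module.End R M)ᵐᵒᵖ] Π₀ a, SimpleMod R M (Z a) :=
  { (toSimpleMod R M X).symm.trans (θ.toAddEquiv.trans
      (DFinsupp.mapRange.addEquiv fun a => toSimpleMod R M (Z a))) with
    map_smul' := fun t x => by
      refine DFinsupp.ext fun a => ?_
      exact congrArg (fun y => toSimpleMod R M (Z a) (y a)) (θ.map_smul (endToCompl R M t) x) }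

theorem dimVec_eq_toENat_mk [Module.Finite R M] (hd : EndDense R M) {s : ℕ}
    {L : Fin s → Type w} [∀ i, AddCommGroup (L i)] [∀ i, Module (RHat R) (L i)]
    [∀ i, IsLocalRing (Module.End (RHat R) (L i))]
    (hL : ∀ i, IsRetract (RHat R) (L i) (MHat R M))
    (hpair : ∀ i j, i ≠ j → IsEmpty (L i ≃ₗ[RHat R] L j)) {X : Type v} [AddCommGroup X]
    [Module R X] (E : HomTop R M X ≃ₗ[(Module.End R M)ᵐᵒᵖ] SimpleMod R M (RHat R ⊗[R] X))
    {Λ : Type*} {c : Λ → Fin s}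
    (θ : HomTop (RHat R) (MHat R M) (RHat R ⊗[R] X) ≃ₗ[(Module.End (RHat R) (MHat R M))ᵐᵒᵖ]
      Π₀ a, HomTop (RHat R) (MHat R M) (L (c a))) (i : Fin s) :
    dimVec R M L X i = Cardinal.toENat (Cardinal.mk {a // c a = i}) := by
  have hs (i) := hd.isSimpleModule_simpleMod (isSimpleModule_homTop (hL i))
  have := hs i
  have hsc (a) := hs (c a)
  have h_iff (a : Λ) : Nonempty (SimpleMod R M (L i) ≃ₗ[(Module.End R M)ᵐᵒᵖ]
      SimpleMod R M (L (c a))) ↔ c a = i := by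
    refine ⟨fun ⟨φ⟩ => ?_, fun h => h ▸ ⟨LinearEquiv.refl _ _⟩⟩
    obtain ⟨ψ⟩ := hd.nonempty_homTop_equiv φ
    by_contra hne
    obtain ⟨f⟩ := nonempty_linearEquiv_of_homTop (hL i) (hL (c a)) ψ
    exact (hpair i (c a) (Ne.symm hne)).false f
  rw [dimVec, homDim_eq_of_linearEquiv_dfinsupp (E.trans (simpleModDFinsupp θ))]
  exact congrArg _ (Cardinal.mk_congr (Equiv.subtypeEquivRight h_iff))

end SimpleMod

/-! ### Base change -/

section BaseChange

variable {R B : Type*} [CommRing R] [CommRing B] [Algebra R B]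

theorem exists_add_smul_of_isBaseChange {H Hc : Type*} [AddCommGroup H] [Module R H]
    [AddCommGroup Hc] [Module R Hc] [Module B Hc] [IsScalarTower R B Hc] {j : H →ₗ[R] Hc}
    (hj : IsBaseChange B j) {r : R}
    (hr : ∀ b : B, ∃ (ρ : R) (b' : B), b = algebraMap R B ρ + r • b') (z : Hc) :
    ∃ (h : H) (z' : Hc), z = j h + r • z' := by
  induction z using hj.inductionOn with
  | zero => exact ⟨0, 0, by rw [map_zero, smul_zero, add_zero]⟩
  | tmul h => exact ⟨h, 0, by rw [smul_zero, add_zero]⟩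
  | smul b z ih =>
    obtain ⟨h, z', rfl⟩ := ih
    obtain ⟨ρ, b', rfl⟩ := hr b
    refine ⟨ρ • h, b' • j h + (algebraMap R B ρ + r • b') • z', ?_⟩
    rw [map_smul, smul_add, smul_add, add_smul, algebraMap_smul, smul_comm _ r z',
      smul_assoc, add_assoc]
  | add x y hx hy =>
    obtain ⟨h, z', rfl⟩ := hx
    obtain ⟨h₂, z₂, rfl⟩ := hy
    exact ⟨h + h₂, z' + z₂, by rw [map_add, smul_add]; abel⟩

theorem isBaseChange_compRight [Module.Flat R B] {A X N : Type*}
    [AddCommGroup A] [Module R A] [Module.FinitePresentation R A] [AddCommGroup X] [Module R X]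
    [AddCommGroup N] [Module R N] [Module B N] [IsScalarTower R B N] {ε : X →ₗ[R] N}
    (hε : IsBaseChange B ε) : IsBaseChange B (LinearMap.compRight R ε (M := A)) := by
  obtain ⟨n, m, f, g, hf, hfg⟩ := Module.FinitePresentation.exists_fin' R A
  exact IsBaseChange.of_left_exact B (LinearMap.compRight R ε)
    (LinearMap.compRight R ε (M := Fin n → R)) (LinearMap.compRight R ε (M := Fin m → R))
    (f := LinearMap.lcomp R X f) (g := LinearMap.lcomp R X g)
    (f' := LinearMap.lcomp B N f) (g' := LinearMap.lcomp B N g)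
    (LinearMap.ext fun _ => rfl) (LinearMap.ext fun _ => rfl)
    (hε.linearMapRight _) (hε.linearMapRight _)
    (LinearMap.exact_lcomp_of_exact_of_surjective X hfg hf)
    (LinearMap.lcomp_injective_of_surjective (S := R) (N := X) f hf)
    (LinearMap.exact_lcomp_of_exact_of_surjective (R := R) N hfg hf)
    (LinearMap.lcomp_injective_of_surjective (S := B) (N := N) f hf)

variable {H Hc H' Hc' : Type*} [AddCommGroup H] [Module R H]
  [AddCommGroup Hc] [Module R Hc] [Module B Hc] [IsScalarTower R B Hc]
  [AddCommGroup H'] [Module R H']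
  [AddCommGroup Hc'] [Module R Hc'] [Module B Hc'] [IsScalarTower R B Hc']
  {j : H →ₗ[R] Hc} {j' : H' →ₗ[R] Hc'} (φ : H →ₗ[R] H') (φc : Hc →ₗ[B] Hc')

theorem equiv_baseChange_apply (hj : IsBaseChange B j) (hj' : IsBaseChange B j')
    (hφ : ∀ h, φc (j h) = j' (φ h)) (t : B ⊗[R] H) :
    hj'.equiv (φ.baseChange B t) = φc (hj.equiv t) := by
  induction t with
  | zero => simp only [map_zero]
  | add x y hx hy => simp only [map_add, hx, hy]
  | tmul b h => simp only [LinearMap.baseChange_tmul, IsBaseChange.equiv_tmul, map_smul, hφ]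

theorem mem_range_of_isBaseChange [Module.FaithfullyFlat R B]
    (hj : IsBaseChange B j) (hj' : IsBaseChange B j')
    (hφ : ∀ h, φc (j h) = j' (φ h)) {w : H'} (hw : j' w ∈ LinearMap.range φc) :
    w ∈ LinearMap.range φ := by
  obtain ⟨z, hz⟩ := hw
  obtain ⟨t, rfl⟩ := hj.equiv.surjective z
  have ht : φ.baseChange B t = 1 ⊗ₜ w := hj'.equiv.injective <| by
    rw [equiv_baseChange_apply φ φc hj hj' hφ, hz, IsBaseChange.equiv_tmul, one_smul]
  rw [← Submodule.ker_mkQ (LinearMap.range φ), LinearMap.mem_ker]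
  refine (Module.FaithfullyFlat.one_tmul_eq_zero_iff R _ (A := B) _).mp ?_
  rw [← LinearMap.baseChange_tmul, ← ht, ← LinearMap.comp_apply, ← LinearMap.baseChange_comp,
    LinearMap.range_mkQ_comp, LinearMap.baseChange_zero, LinearMap.zero_apply]

theorem exists_eq_smul_of_isBaseChange [Module.FaithfullyFlat R B] (hj : IsBaseChange B j) {r : R}
    {h : H} {z : Hc} (hz : j h = r • z) : ∃ k : H, h = r • k := by
  obtain ⟨k, hk⟩ := mem_range_of_isBaseChange (LinearMap.lsmul R H r)
    (LinearMap.lsmul B Hc (algebraMap R B r)) hj hj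
    (fun g => by rw [LinearMap.lsmul_apply, LinearMap.lsmul_apply, map_smul, algebraMap_smul])
    ⟨z, by rw [LinearMap.lsmul_apply, algebraMap_smul, hz]⟩
  exact ⟨k, hk.symm⟩

theorem exists_approx_of_isBaseChange [Module.FaithfullyFlat R B]
    (hj : IsBaseChange B j) (hj' : IsBaseChange B j')
    (hφ : ∀ h, φc (j h) = j' (φ h)) {r : R}
    (hr : ∀ b : B, ∃ (ρ : R) (b' : B), b = algebraMap R B ρ + r • b')
    {w : H'} {z : Hc} (hw : φc z = j' w) :
    ∃ (y : H) (z' : Hc), φ y = w ∧ j y = z + r • z' := by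
  obtain ⟨y₀, hy₀⟩ := mem_range_of_isBaseChange φ φc hj hj' hφ ⟨z, hw⟩
  obtain ⟨t, ht⟩ := hj.equiv.surjective (z - j y₀)
  have ht_ker : φ.baseChange B t = 0 := hj'.equiv.injective <| by
    rw [equiv_baseChange_apply φ φc hj hj' hφ, ht, map_sub, hw, hφ, hy₀, sub_self, map_zero]
  obtain ⟨k, hk⟩ :=
    (Module.Flat.lTensor_exact B (LinearMap.exact_subtype_ker_map φ) t).mp ht_ker
  obtain ⟨k₀, k', rfl⟩ := exists_add_smul_of_isBaseChange
    (TensorProduct.isBaseChange R (LinearMap.ker φ) B) hr k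
  let ψ : B ⊗[R] LinearMap.ker φ →ₗ[R] Hc :=
    hj.equiv.toLinearMap.restrictScalars R ∘ₗ (LinearMap.ker φ).subtype.lTensor B
  have hk₀ : ψ (1 ⊗ₜ k₀) = j k₀ := (hj.equiv_tmul 1 _).trans (one_smul B _)
  have hsplit : j k₀ + r • ψ k' = z - j y₀ := by
    rw [← hk₀, ← map_smul, ← map_add, ← ht, ← hk]
    rfl
  refine ⟨y₀ + k₀, -ψ k', ?_, ?_⟩
  · rw [map_add, hy₀, LinearMap.mem_ker.mp k₀.2, add_zero]
  · rw [map_add, smul_neg, ← sub_eq_add_neg, eq_sub_iff_add_eq, add_assoc, hsplit,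
      add_sub_cancel]

end BaseChange

/-! ### Locally split modules -/

section LocallySplit

variable {R M X : Type*} [Ring R] [AddCommGroup M] [Module R M] [AddCommGroup X] [Module R X]

theorem IsCountablyGenerated.exists_span_range_eq_top (hX : IsCountablyGenerated R X) :
    ∃ x : ℕ → X, Submodule.span R (Set.range x) = ⊤ := by
  obtain ⟨G, hG, hspan⟩ := hX
  rcases G.eq_empty_or_nonempty with rfl | hne
  · exact ⟨0, top_le_iff.mp (hspan.symm.le.trans (Submodule.span_mono (Set.empty_subset _)))⟩
  · obtain ⟨x, rfl⟩ := hG.exists_eq_range hne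
    exact ⟨x, hspan⟩

theorem isRetract_dfinsupp_of_telescope {Z : ℕ → Type*} [∀ n, AddCommGroup (Z n)]
    [∀ n, Module R (Z n)] {θ : ℕ → X →ₗ[R] X} (s : ∀ n, X →ₗ[R] Z n) (p : ∀ n, Z n →ₗ[R] X)
    (h_zero : θ 0 = LinearMap.id) (h_succ : ∀ n, θ (n + 1) = θ n - p n ∘ₗ s n ∘ₗ θ n)
    (h_eventually : ∀ y, ∃ m, ∀ n, m ≤ n → θ n y = 0) : IsRetract R X (Π₀ n, Z n) := by
  choose m hm using h_eventually
  let e : X →ₗ[R] Π₀ n, Z n :=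
    { toFun y := ⟨fun n => s n (θ n y), .mk ⟨Multiset.range (m y), fun n =>
        (lt_or_ge n (m y)).imp Multiset.mem_range.mpr fun h => by rw [hm y n h, map_zero]⟩⟩
      map_add' y z := DFinsupp.ext fun n => map_add (s n ∘ₗ θ n) y z
      map_smul' c y := DFinsupp.ext fun n => map_smul (s n ∘ₗ θ n) c y }
  refine ⟨e, DFinsupp.lsum ℕ p, LinearMap.ext fun y => ?_⟩
  have he : e y = ∑ n ∈ Finset.range (m y), DFinsupp.single n (s n (θ n y)) := by
    ext n
    rw [DFinsupp.finsetSum_apply]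
    simp only [DFinsupp.single_apply, Finset.sum_dite_eq', Finset.mem_range]
    split_ifs with hn
    · rfl
    · exact (congrArg (s n) (hm y n (not_lt.mp hn))).trans (map_zero _)
  calc DFinsupp.lsum ℕ p (e y) = ∑ n ∈ Finset.range (m y), (θ n y - θ (n + 1) y) := by
        rw [he, map_sum]
        refine Finset.sum_congr rfl fun n _ => ?_
        rw [DFinsupp.lsum_single, h_succ, LinearMap.sub_apply, sub_sub_cancel]
        rfl
    _ = y := by rw [Finset.sum_range_sub', hm y _ le_rfl, sub_zero, h_zero, LinearMap.id_apply]

theorem exists_eventually_eq_zero {x : ℕ → X} (hx : Submodule.span R (Set.range x) = ⊤)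
    {θ : ℕ → X →ₗ[R] X} (hθ : ∀ i n, i < n → θ n (x i) = 0) (y : X) :
    ∃ m, ∀ n, m ≤ n → θ n y = 0 := by
  have hy : y ∈ Submodule.span R (Set.range x) := hx ▸ Submodule.mem_top
  induction hy using Submodule.span_induction with
  | mem y hy => obtain ⟨i, rfl⟩ := hy; exact ⟨i + 1, fun n hn => hθ i n hn⟩
  | zero => exact ⟨0, fun n _ => map_zero _⟩
  | add y z _ _ hy hz =>
    obtain ⟨m, hm⟩ := hy
    obtain ⟨m', hm'⟩ := hz
    refine ⟨max m m', fun n hn => ?_⟩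
    rw [map_add, hm n (le_of_max_le_left hn), hm' n (le_of_max_le_right hn), add_zero]
  | smul a y _ hy =>
    obtain ⟨m, hm⟩ := hy
    exact ⟨m, fun n hn => by rw [map_smul, hm n hn, smul_zero]⟩

theorem exists_isRetract_finsupp_of_locally_split (hX : IsCountablyGenerated R X)
    (hloc : ∀ S : Finset X, ∃ (k : ℕ) (s : X →ₗ[R] (Fin k → M)) (p : (Fin k → M) →ₗ[R] X),
      ∀ x ∈ S, p (s x) = x) :
    ∃ k : ℕ → ℕ, IsRetract R X ((Σ n, Fin (k n)) →₀ M) := by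
  classical
  obtain ⟨x, hx⟩ := hX.exists_span_range_eq_top
  choose k s p hps using hloc
  let S (n : ℕ) (θ : X →ₗ[R] X) : Finset X := (Finset.range (n + 1)).image fun i => θ (x i)
  let θ (n : ℕ) : X →ₗ[R] X := Nat.rec LinearMap.id
    (fun n θ => θ - p (S n θ) ∘ₗ s (S n θ) ∘ₗ θ) n
  have hsucc (n : ℕ) : θ (n + 1) = θ n - p (S n (θ n)) ∘ₗ s (S n (θ n)) ∘ₗ θ n := rfl
  have hθ : ∀ i n, i < n → θ n (x i) = 0 := by
    intro i n hin
    induction n, hin using Nat.le_induction with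
    | base =>
      rw [hsucc, LinearMap.sub_apply, LinearMap.comp_apply, LinearMap.comp_apply,
        hps _ _ (Finset.mem_image_of_mem _ (Finset.self_mem_range_succ i)), sub_self]
    | succ n _ ih =>
      rw [hsucc, LinearMap.sub_apply, LinearMap.comp_apply, LinearMap.comp_apply, ih, map_zero,
        map_zero, sub_zero]
  let e : (Π₀ n, Fin (k (S n (θ n))) → M) ≃ₗ[R] ((Σ n, Fin (k (S n (θ n)))) →₀ M) :=
    (DFinsupp.mapRange.linearEquiv fun n => (Finsupp.linearEquivFunOnFinite R M _).symm).trans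
      (sigmaFinsuppLequivDFinsupp R).symm
  exact ⟨_, (isRetract_dfinsupp_of_telescope (fun n => s (S n (θ n))) (fun n => p (S n (θ n)))
    rfl hsucc (exists_eventually_eq_zero hx hθ)).trans (.of_linearEquiv e)⟩

end LocallySplit

/-! ### Descent of direct summands -/

section Descent

theorem exists_linearMap_of_extensible {R X G : Type*} [Ring R] [AddCommGroup X] [Module R X]
    [AddCommGroup G] [Module R G] (hX : IsCountablyGenerated R X) {P : (X →ₗ.[R] G) → Prop}
    (hbot : P ⊥) (hext : ∀ p, P p → ∀ x : X, ∃ p', P p' ∧ p ≤ p' ∧ x ∈ p'.domain) :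
    ∃ s : X →ₗ[R] G, ∀ x, ∃ p, P p ∧ ∃ hx : x ∈ p.domain, s x = p ⟨x, hx⟩ := by
  obtain ⟨x, hspan⟩ := hX.exists_span_range_eq_top
  choose! next hP hle hmem using hext
  let p (n : ℕ) : X →ₗ.[R] G := Nat.rec ⊥ (fun n q => next q (x n)) n
  have hPp (n : ℕ) : P (p n) := by
    induction n with
    | zero => exact hbot
    | succ n ih => exact hP _ ih (x n)
  have hdir : DirectedOn (· ≤ ·) (Set.range p) :=
    (monotone_nat_of_le_succ fun n => hle _ (hPp n) (x n)).directed_le.directedOn_range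
  have hdom : (LinearPMap.sSup _ hdir).domain = ⊤ := by
    rw [eq_top_iff, ← hspan, Submodule.span_le]
    rintro _ ⟨n, rfl⟩
    exact (LinearPMap.le_sSup hdir ⟨n + 1, rfl⟩).1 (hmem _ (hPp n) (x n))
  have hmem_dom (a : X) : a ∈ (LinearPMap.sSup _ hdir).domain := hdom ▸ Submodule.mem_top
  refine ⟨(LinearPMap.sSup _ hdir).toFun ∘ₗ LinearMap.id.codRestrict _ hmem_dom, fun a => ?_⟩
  obtain ⟨_, ⟨n, rfl⟩, hn⟩ :=
    (LinearPMap.mem_domain_sSup_iff (Set.range_nonempty p) hdir).mp (hmem_dom a)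
  exact ⟨p n, hPp n, hn,
    ((LinearPMap.le_sSup hdir ⟨n, rfl⟩).2 (x := ⟨a, hn⟩) (y := ⟨a, hmem_dom a⟩) rfl).symm⟩

theorem bijective_of_forall_eq_add_smul {B C : Type*} [CommRing B] [AddCommGroup C] [Module B C]
    [Module.Finite B C] {b : B} (hb : b ∈ Ideal.jacobson (⊥ : Ideal B)) {u : C →ₗ[B] C}
    (hu : ∀ c, ∃ d, u c = c + b • d) : Function.Bijective u := by
  have hsurj : Function.Surjective u := by
    rw [← LinearMap.range_eq_top, ← top_le_iff]
    refine Submodule.le_of_le_smul_of_le_jacobson_bot Module.Finite.fg_top le_rfl fun c _ => ?_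
    obtain ⟨d, hd⟩ := hu c
    rw [← sub_eq_of_eq_add hd]
    exact Submodule.sub_mem_sup ⟨c, rfl⟩ (Submodule.smul_mem_smul hb Submodule.mem_top)
  exact ⟨OrzechProperty.injective_of_surjective_endomorphism u hsurj, hsurj⟩

theorem exists_eq_add_smul_of_isBaseChange {R B X N Y : Type*} [CommRing R] [CommRing B]
    [Algebra R B] [AddCommGroup X] [Module R X] [AddCommGroup N] [Module R N] [Module B N]
    [IsScalarTower R B N] [AddCommGroup Y] [Module B Y] {ε : X →ₗ[R] N}
    (hε : IsBaseChange B ε) {b : B} {g h : N →ₗ[B] Y}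
    (hgh : ∀ x, ∃ z, g (ε x) = h (ε x) + b • z) (y : N) :
    ∃ z, g y = h y + b • z := by
  induction y using hε.inductionOn with
  | zero => exact ⟨0, by simp only [map_zero, smul_zero, add_zero]⟩
  | tmul x => exact hgh x
  | smul c y ih =>
    obtain ⟨z, hz⟩ := ih
    exact ⟨c • z, by rw [map_smul, hz, map_smul, smul_add, smul_comm]⟩
  | add y y' hy hy' =>
    obtain ⟨z, hz⟩ := hy
    obtain ⟨z', hz'⟩ := hy'
    exact ⟨z + z', by rw [map_add, hz, hz', map_add, smul_add]; abel⟩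

variable {R B : Type*} [CommRing R] [CommRing B] [Algebra R B]
  {X N G Gc : Type*} [AddCommGroup X] [Module R X] [AddCommGroup N]
  [Module R N] [Module B N] [IsScalarTower R B N] [AddCommGroup G] [Module R G]
  [AddCommGroup Gc] [Module R Gc] [Module B Gc] [IsScalarTower R B Gc] {ε : X →ₗ[R] N}
  {γ : G →ₗ[R] Gc}

/-- A partial approximation of `f` along `ε` and `γ`: a homomorphism `p` defined on a finitely
generated submodule of `X` which agrees with `f` modulo `r` there. The correction is required to
extend to `N`, since this is what allows `p` itself to be extended. -/
def IsApprox (ε : X →ₗ[R] N) (γ : G →ₗ[R] Gc) (f : N →ₗ[B] Gc) (r : R) (p : X →ₗ.[R] G) : Prop :=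
  p.domain.FG ∧ ∃ h : N →ₗ[B] Gc, ∀ x : p.domain, γ (p x) = f (ε x) + r • h (ε x)

theorem IsApprox.exists_extension [IsNoetherianRing R] [Module.FaithfullyFlat R B]
    (hγ : IsBaseChange B γ) {r : R}
    (hr : ∀ t : ℕ, ∀ b : B, ∃ (ρ : R) (b' : B), b = algebraMap R B ρ + r ^ t • b')
    (hext : ∀ A : Submodule R X, A.FG → ∃ t : ℕ, ∀ ψ : A →ₗ[R] Gc,
      ∃ Ψ : N →ₗ[B] Gc, ∀ a : A, Ψ (ε a) = r ^ t • ψ a)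
    {f : N →ₗ[B] Gc} {p : X →ₗ.[R] G} (hp : IsApprox ε γ f r p) (x : X) :
    ∃ p', IsApprox ε γ f r p' ∧ p ≤ p' ∧ x ∈ p'.domain := by
  obtain ⟨hfg, h, hp⟩ := hp
  have hle : p.domain ≤ p.domain ⊔ R ∙ x := le_sup_left
  have hA : (p.domain ⊔ R ∙ x).FG := hfg.sup (Submodule.fg_span_singleton x)
  have hfinA : Module.Finite R ↥(p.domain ⊔ R ∙ x) := Module.Finite.iff_fg.mpr hA
  have hfinD : Module.Finite R p.domain := Module.Finite.iff_fg.mpr hfg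
  have := Module.finitePresentation_of_finite R ↥(p.domain ⊔ R ∙ x)
  have := Module.finitePresentation_of_finite R p.domain
  obtain ⟨t, ht⟩ := hext _ hA
  let ι := Submodule.inclusion hle
  obtain ⟨y, ψ, hy, hψ⟩ := exists_approx_of_isBaseChange
    (LinearMap.lcomp R G ι) (LinearMap.lcomp B Gc ι)
    (isBaseChange_compRight hγ) (isBaseChange_compRight hγ) (fun _ => rfl) (hr (t + 1))
    (w := p.toFun) (z := ((f + r • h).restrictScalars R ∘ₗ ε) ∘ₗ (p.domain ⊔ R ∙ x).subtype)
    (LinearMap.ext fun a => (hp a).symm)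
  obtain ⟨Ψ, hΨ⟩ := ht ψ
  refine ⟨⟨_, y⟩, ⟨hA, h + Ψ, fun a => ?_⟩, ⟨hle, fun a b hab => ?_⟩,
    (le_sup_right : R ∙ x ≤ p.domain ⊔ R ∙ x) (Submodule.mem_span_singleton_self x)⟩
  · have ha : γ (y a) = f (ε a) + r • h (ε a) + r ^ (t + 1) • ψ a := LinearMap.congr_fun hψ a
    change γ (y a) = _
    rw [ha, LinearMap.add_apply, hΨ, smul_add, pow_succ', mul_smul, add_assoc]
  · exact (LinearMap.congr_fun hy a).symm.trans (congrArg y (Subtype.ext hab))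

theorem exists_approx_hom [IsNoetherianRing R] [Module.FaithfullyFlat R B]
    (hγ : IsBaseChange B γ) (hX : IsCountablyGenerated R X) {r : R}
    (hr : ∀ t : ℕ, ∀ b : B, ∃ (ρ : R) (b' : B), b = algebraMap R B ρ + r ^ t • b')
    (hext : ∀ A : Submodule R X, A.FG → ∃ t : ℕ, ∀ ψ : A →ₗ[R] Gc,
      ∃ Ψ : N →ₗ[B] Gc, ∀ a : A, Ψ (ε a) = r ^ t • ψ a) (f : N →ₗ[B] Gc) :
    ∃ s : X →ₗ[R] G, ∀ x, ∃ z, γ (s x) = f (ε x) + r • z := by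
  have hbot : IsApprox ε γ f r ⊥ := ⟨Submodule.fg_bot, 0, fun a => by
    rw [(Submodule.mem_bot R).mp a.2, LinearMap.zero_apply, smul_zero, add_zero, map_zero, map_zero]
    exact map_zero γ⟩
  obtain ⟨s, hs⟩ := exists_linearMap_of_extensible hX hbot
    fun p hp x => hp.exists_extension hγ hr hext x
  refine ⟨s, fun x => ?_⟩
  obtain ⟨p, ⟨-, h, hp⟩, hx, hsx⟩ := hs x
  exact ⟨h (ε x), hsx ▸ hp ⟨x, hx⟩⟩

theorem exists_local_splitting [IsNoetherianRing R] [Module.FaithfullyFlat R B]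
    [Module.Finite R G] (hε : IsBaseChange B ε) {r : R}
    (hr : algebraMap R B r ∈ Ideal.jacobson (⊥ : Ideal B))
    {C : Type*} [AddCommGroup C] [Module B C] [Module.Finite B C]
    {ι : C →ₗ[B] N} {κ : N →ₗ[B] C} (hκι : κ ∘ₗ ι = LinearMap.id)
    {a : C →ₗ[B] Gc} {b : Gc →ₗ[B] C} (hba : b ∘ₗ a = LinearMap.id)
    {s : X →ₗ[R] G} (hs : ∀ x, ∃ z, γ (s x) = a (κ (ε x)) + r • z)
    {A : Submodule R X} (hA : A.FG) (hAC : ∀ x ∈ A, ε x ∈ LinearMap.range ι) :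
    ∃ p : G →ₗ[R] X, ∀ x ∈ A, p (s x) = x := by
  have hfinA : Module.Finite R A := Module.Finite.iff_fg.mpr hA
  have := Module.finitePresentation_of_finite R A
  have := Module.finitePresentation_of_finite R G
  let sc : N →ₗ[B] Gc := hε.lift (γ ∘ₗ s)
  have hsc (x : X) : sc (ε x) = γ (s x) := hε.lift_eq (γ ∘ₗ s) x
  have hscκ : ∀ y, ∃ z, sc y = (a ∘ₗ κ) y + algebraMap R B r • z :=
    exists_eq_add_smul_of_isBaseChange hε fun x => by
      simpa only [hsc, algebraMap_smul] using! hs x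
  let u : C →ₗ[B] C := b ∘ₗ sc ∘ₗ ι
  have hu : Function.Bijective u := bijective_of_forall_eq_add_smul hr fun c => by
    obtain ⟨z, hz⟩ := hscκ (ι c)
    refine ⟨b z, ?_⟩
    calc b (sc (ι c)) = b (a (κ (ι c))) + algebraMap R B r • b z := by
          rw [hz, map_add, map_smul]; rfl
      _ = c + algebraMap R B r • b z := by
          rw [show κ (ι c) = c from LinearMap.congr_fun hκι c,
            show b (a c) = c from LinearMap.congr_fun hba c]
  let pc : Gc →ₗ[B] N := ι ∘ₗ (LinearEquiv.ofBijective u hu).symm.toLinearMap ∘ₗ b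
  have hpc (x : X) (hx : x ∈ A) : pc (γ (s x)) = ε x := by
    obtain ⟨c, hc⟩ := hAC x hx
    rw [← hsc, ← hc]
    exact congrArg ι ((LinearEquiv.ofBijective u hu).symm_apply_apply c)
  obtain ⟨p, hp⟩ := mem_range_of_isBaseChange (LinearMap.lcomp R X (s ∘ₗ A.subtype))
    (LinearMap.lcomp B N (s ∘ₗ A.subtype)) (isBaseChange_compRight hε)
    (isBaseChange_compRight hε) (fun _ => rfl) (w := A.subtype)
    ⟨pc.restrictScalars R ∘ₗ γ, LinearMap.ext fun x => hpc x x.2⟩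
  exact ⟨p, fun x hx => LinearMap.congr_fun hp ⟨x, hx⟩⟩

end Descent

/-! ### One-dimensional local domains and their completions -/

section Complete

variable {A X : Type*} [CommRing A] [AddCommGroup X] [Module A X] (I : Ideal A)

instance isPrecomplete_pi [IsPrecomplete I X] {κ : Type*} [Finite κ] :
    IsPrecomplete I (κ → X) := by
  classical
  have := Fintype.ofFinite κ
  rw [← AdicCompletion.of_surjective_iff]
  intro y
  choose x hx using fun i => AdicCompletion.of_surjective I X
    (AdicCompletion.piEquivOfFintype I (fun _ : κ => X) y i)
  refine ⟨x, (AdicCompletion.piEquivOfFintype I fun _ : κ => X).injective (funext fun i => ?_)⟩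
  rw [← hx, AdicCompletion.piEquivOfFintype_apply]
  rfl

theorem isHausdorff_submodule [IsHausdorff I X] (P : Submodule A X) : IsHausdorff I P := by
  refine ⟨fun x hx => Subtype.ext (IsHausdorff.haus (I := I) ‹_› _ fun n => ?_)⟩
  have h := Submodule.mem_map_of_mem (f := P.subtype) (SModEq.zero.mp (hx n))
  rw [Submodule.map_smul''] at h
  exact SModEq.zero.mpr (Submodule.smul_mono le_rfl le_top h)

theorem exists_eq_smul_of_mem {r : A} {x : X} (hx : x ∈ (Ideal.span {r} • ⊤ : Submodule A X)) :
    ∃ y, x = r • y := by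
  rw [Submodule.ideal_span_singleton_smul, Submodule.mem_smul_pointwise_iff_exists] at hx
  obtain ⟨y, -, rfl⟩ := hx
  exact ⟨y, rfl⟩

variable {I}

theorem exists_algebraMap_add_smul_of_pow_le (hI : I.FG) {r : A} {n : ℕ}
    (hn : I ^ n ≤ Ideal.span {r}) (b : AdicCompletion I A) :
    ∃ (ρ : A) (b' : AdicCompletion I A), b = algebraMap A (AdicCompletion I A) ρ + r • b' := by
  obtain ⟨ρ, hρ⟩ := Submodule.mkQ_surjective _ (AdicCompletion.eval I A n b)
  have hker : b - AdicCompletion.of I A ρ ∈ (AdicCompletion.eval I A n).ker := by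
    rw [LinearMap.mem_ker, map_sub, ← hρ, AdicCompletion.eval_of, sub_self]
  rw [← AdicCompletion.pow_smul_top_eq_ker_eval hI] at hker
  obtain ⟨b', hb'⟩ := exists_eq_smul_of_mem (Submodule.smul_mono_left hn hker)
  exact ⟨ρ, b', eq_add_of_sub_eq' hb'⟩

end Complete

section NoetherianOfQuotient

variable {A : Type*} [CommRing A] {I : Ideal A} {r : A}

theorem exists_fin_le_span_sup_of_isNoetherianRing_quotient
    [IsNoetherianRing (A ⧸ Ideal.span {r})] (P : Ideal A) :
    ∃ (k : ℕ) (a : Fin k → P), P ≤ Ideal.span (Set.range fun i => (a i : A)) ⊔ Ideal.span {r} := by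
  let π := Ideal.Quotient.mk (Ideal.span {r})
  obtain ⟨k, g, hg⟩ := Submodule.fg_iff_exists_fin_generating_family.mp
    (IsNoetherian.noetherian (P.map π))
  choose a ha hag using fun i => (Ideal.mem_map_iff_of_surjective π Ideal.Quotient.mk_surjective).mp
    (hg.le (Submodule.subset_span ⟨i, rfl⟩))
  refine ⟨k, fun i => ⟨a i, ha i⟩, ?_⟩
  have hle : P.map π ≤ (Ideal.span (Set.range a)).map π := by
    rw [Ideal.map_span, ← Set.range_comp]
    exact hg.ge.trans (Ideal.span_mono (Set.range_subset_range_iff_exists_comp.mpr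
      ⟨id, funext fun i => (hag i).symm⟩))
  rwa [Ideal.map_le_iff_le_comap, Ideal.comap_map_of_surjective' π Ideal.Quotient.mk_surjective,
    Ideal.mk_ker] at hle

theorem fg_of_le_span_sup_of_notMem [IsAdicComplete I A] (hr : r ∈ I) {P : Ideal A} [P.IsPrime]
    (hrP : r ∉ P) {k : ℕ} {a : Fin k → P}
    (ha : P ≤ Ideal.span (Set.range fun i => (a i : A)) ⊔ Ideal.span {r}) : P.FG := by
  let f : (Fin k → A) →ₗ[A] P := Fintype.linearCombination A a
  have hfc (c : Fin k → A) : (f c : A) = ∑ i, c i * a i := by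
    simp only [f, Fintype.linearCombination_apply, Submodule.coe_sum, Submodule.coe_smul,
      smul_eq_mul]
  have := isHausdorff_submodule I P
  have hf : Function.Surjective f := by
    refine surjective_of_mkQ_comp_surjective (I := I) <|
      (Submodule.mkQ_surjective _).forall.mpr fun p => ?_
    obtain ⟨y, hy, z, hz, hyz⟩ := Submodule.mem_sup.mp (ha p.2)
    obtain ⟨c, rfl⟩ := Ideal.mem_span_range_iff_exists_fun.mp hy
    obtain ⟨w, rfl⟩ := Ideal.mem_span_singleton'.mp hz
    have hwr : (p : A) = f c + w * r := by rw [hfc, hyz]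
    have hw : w ∈ P := (Ideal.IsPrime.mem_or_mem ‹_› <|
      (Submodule.add_mem_iff_right P (f c).2).mp (hwr ▸ p.2)).resolve_right hrP
    refine ⟨c, (Submodule.Quotient.eq _).mpr ?_⟩
    have : f c - p = r • (-⟨w, hw⟩ : P) := Subtype.ext <| by
      simp only [Submodule.coe_sub, Submodule.coe_smul, Submodule.coe_neg, smul_eq_mul, hwr]
      ring
    exact this ▸ Submodule.smul_mem_smul hr trivial
  have := Module.Finite.of_surjective f hf
  exact (Submodule.fg_top P).mp Module.Finite.fg_top

theorem isNoetherianRing_of_isNoetherianRing_quotient_span [IsAdicComplete I A] (hr : r ∈ I)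
    [IsNoetherianRing (A ⧸ Ideal.span {r})] : IsNoetherianRing A := by
  refine IsNoetherianRing.of_prime fun P hP => ?_
  obtain ⟨k, a, ha⟩ := exists_fin_le_span_sup_of_isNoetherianRing_quotient (r := r) P
  by_cases hrP : r ∈ P
  · have : P = Ideal.span (Set.range fun i => (a i : A)) ⊔ Ideal.span {r} :=
      le_antisymm ha <| sup_le (Ideal.span_le.mpr (Set.range_subset_iff.mpr fun i => (a i).2))
        ((Ideal.span_singleton_le_iff_mem P).mpr hrP)
    rw [this]
    exact Submodule.FG.sup (Submodule.fg_span (Set.finite_range _)) (Submodule.fg_span_singleton _)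
  · exact fg_of_le_span_sup_of_notMem hr hrP ha

end NoetherianOfQuotient

section OneDimensional

theorem exists_mem_maximalIdeal_ne_zero {R : Type*} [CommRing R] [IsLocalRing R]
    (hdim : ringKrullDim R = 1) : ∃ r ∈ IsLocalRing.maximalIdeal R, r ≠ 0 := by
  refine (Submodule.ne_bot_iff _).mp fun h => ?_
  let _ := (IsLocalRing.isField_iff_maximalIdeal_eq.mpr h).toField
  rw [ringKrullDim_eq_zero_of_field] at hdim
  exact zero_ne_one hdim

theorem exists_maximalIdeal_pow_le {R : Type*} [CommRing R] [IsDomain R] [IsNoetherianRing R]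
    [IsLocalRing R] (hdim : ringKrullDim R = 1) {r : R} (hr : r ≠ 0) :
    ∃ n, IsLocalRing.maximalIdeal R ^ n ≤ Ideal.span {r} := by
  have hle : Ring.KrullDimLE 1 R := Ring.krullDimLE_iff.mpr hdim.le
  rw [Ring.krullDimLE_one_iff_of_noZeroDivisors] at hle
  refine Ideal.exists_pow_le_of_le_radical_of_fg ?_ (IsNoetherian.noetherian _)
  rw [Ideal.radical_eq_sInf]
  refine le_sInf fun P ⟨hrP, hP⟩ => ?_
  have hP0 : P ≠ ⊥ := by
    rintro rfl
    exact hr ((Ideal.span_singleton_le_iff_mem ⊥).mp hrP)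
  exact (IsLocalRing.eq_maximalIdeal (hle P hP0 hP)).ge

theorem mem_minimalPrimes_of_maximalIdeal_pow_le {B : Type*} [CommRing B] [IsNoetherianRing B]
    [IsLocalRing B] {r : B} {n : ℕ} (hn : IsLocalRing.maximalIdeal B ^ n ≤ Ideal.span {r})
    (hr : r ∈ IsLocalRing.maximalIdeal B) {Q : Ideal B} [Q.IsPrime] (hrQ : r ∉ Q) :
    Q ∈ minimalPrimes B := by
  have hspan {J : Ideal B} : Ideal.span {r} ≤ J ↔ r ∈ J := Ideal.span_singleton_le_iff_mem J
  have hmin : IsLocalRing.maximalIdeal B ∈ (Ideal.span {r}).minimalPrimes :=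
    ⟨⟨inferInstance, hspan.mpr hr⟩, fun J hJ _ =>
      have := hJ.1
      Ideal.IsPrime.le_of_pow_le (hn.trans hJ.2)⟩
  have hlt : Q < IsLocalRing.maximalIdeal B :=
    lt_of_le_of_ne (IsLocalRing.le_maximalIdeal Ideal.IsPrime.ne_top') fun h => hrQ (h ▸ hr)
  exact Ideal.height_eq_zero_iff.mp <| Order.lt_one_iff.mp <|
    (Ideal.height_strict_mono_of_isPrime hlt).trans_le
      (Ideal.height_le_one_of_isPrincipal_of_mem_minimalPrimes _ _ hmin)

theorem exists_pow_mem_of_forall_not_le {B : Type*} [CommRing B] [IsNoetherianRing B]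
    [IsLocalRing B] {r : B} {n : ℕ} (hn : IsLocalRing.maximalIdeal B ^ n ≤ Ideal.span {r})
    (hr : r ∈ IsLocalRing.maximalIdeal B) {I : Ideal B} (hI : ∀ P ∈ minimalPrimes B, ¬ I ≤ P) :
    ∃ t, r ^ t ∈ I := by
  suffices r ∈ I.radical from this
  rw [Ideal.radical_eq_sInf, Ideal.mem_sInf]
  rintro Q ⟨hIQ, hQ⟩
  by_contra hrQ
  exact hI Q (mem_minimalPrimes_of_maximalIdeal_pow_le hn hr hrQ) hIQ

variable {R : Type u} [CommRing R] [IsNoetherianRing R] [IsLocalRing R]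

theorem algebraMap_mem_maximalIdeal_completion {r : R} (hr : r ∈ IsLocalRing.maximalIdeal R) :
    algebraMap R (RHat R) r ∈ IsLocalRing.maximalIdeal (RHat R) := by
  rw [AdicCompletion.maximalIdeal_eq_map]
  exact Ideal.mem_map_of_mem _ hr

instance faithfullyFlat_completion : Module.FaithfullyFlat R (RHat R) :=
  have : Module.Flat R (RHat R) := AdicCompletion.flat_of_isNoetherian _
  Module.FaithfullyFlat.of_flat_of_isLocalHom

variable [IsDomain R]

theorem exists_algebraMap_add_smul (hdim : ringKrullDim R = 1) {r : R} (hr : r ≠ 0)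
    (b : RHat R) : ∃ (ρ : R) (b' : RHat R), b = algebraMap R (RHat R) ρ + r • b' :=
  have ⟨_, hn⟩ := exists_maximalIdeal_pow_le hdim hr
  exists_algebraMap_add_smul_of_pow_le (IsNoetherian.noetherian _) hn b

theorem exists_maximalIdeal_completion_pow_le (hdim : ringKrullDim R = 1) {r : R} (hr : r ≠ 0) :
    ∃ n, IsLocalRing.maximalIdeal (RHat R) ^ n ≤ Ideal.span {algebraMap R (RHat R) r} := by
  obtain ⟨n, hn⟩ := exists_maximalIdeal_pow_le hdim hr
  refine ⟨n, ?_⟩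
  rw [AdicCompletion.maximalIdeal_eq_map, ← Ideal.map_pow, ← Set.image_singleton, ← Ideal.map_span]
  exact Ideal.map_mono hn

theorem isNoetherianRing_completion (hdim : ringKrullDim R = 1) : IsNoetherianRing (RHat R) := by
  obtain ⟨r, hrm, hr0⟩ := exists_mem_maximalIdeal_ne_zero hdim
  let r' := algebraMap R (RHat R) r
  have : IsNoetherianRing (RHat R ⧸ Ideal.span {r'}) := by
    refine isNoetherianRing_of_surjective R _
      ((Ideal.Quotient.mk (Ideal.span {r'})).comp (algebraMap R (RHat R))) <|
      Ideal.Quotient.mk_surjective.forall.mpr fun b => ?_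
    obtain ⟨ρ, b', hb⟩ := exists_algebraMap_add_smul hdim hr0 b
    refine ⟨ρ, ?_⟩
    rw [RingHom.comp_apply, Ideal.Quotient.mk_eq_mk_iff_sub_mem, hb, Algebra.smul_def,
      sub_add_cancel_left, neg_mem_iff]
    exact Ideal.mul_mem_right _ _ (Ideal.mem_span_singleton_self r')
  exact isNoetherianRing_of_isNoetherianRing_quotient_span
    (algebraMap_mem_maximalIdeal_completion hrm)

end OneDimensional

/-! ### Local endomorphism rings over complete local rings -/

theorem isAdicComplete_of_finite {B C : Type*} [CommRing B] [IsNoetherianRing B] [IsLocalRing B]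
    [IsAdicComplete (IsLocalRing.maximalIdeal B) B] [AddCommGroup C] [Module B C]
    [Module.Finite B C] : IsAdicComplete (IsLocalRing.maximalIdeal B) C := by
  obtain ⟨n, π, hπ⟩ := Module.Finite.exists_fin' B C
  have : IsPrecomplete (IsLocalRing.maximalIdeal B) C := by
    rw [← AdicCompletion.of_surjective_iff]
    intro y
    obtain ⟨x, rfl⟩ := AdicCompletion.map_surjective _ hπ y
    obtain ⟨x, rfl⟩ := AdicCompletion.of_surjective _ _ x
    exact ⟨π x, (AdicCompletion.map_of _ π x).symm⟩
  constructor

theorem exists_isIdempotentElem_sub_mem {C : Type*} [CommRing C] (I : Ideal C)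
    [HenselianRing C I] {e : C} (he : e * e - e ∈ I) :
    ∃ e', IsIdempotentElem e' ∧ e' - e ∈ I := by
  rcases subsingleton_or_nontrivial C with _ | _
  · exact ⟨e, Subsingleton.elim _ _, (sub_self e).symm ▸ I.zero_mem⟩
  let f : Polynomial C := Polynomial.X ^ 2 - Polynomial.X
  have hf : f.Monic := Polynomial.monic_X_pow_sub (by rw [Polynomial.degree_X]; norm_num)
  have heval (c : C) : f.eval c = c * c - c := by simp [f, sq]
  have hderiv : f.derivative.eval e = 2 * e - 1 := by simp [f, one_add_one_eq_two]
  have hunit : IsUnit (Ideal.Quotient.mk I (f.derivative.eval e)) := by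
    refine IsUnit.of_mul_eq_one (Ideal.Quotient.mk I (2 * e - 1)) ?_
    rw [hderiv, ← map_mul, ← map_one (Ideal.Quotient.mk I), Ideal.Quotient.mk_eq_mk_iff_sub_mem]
    convert I.mul_mem_left 4 he using 1
    ring
  obtain ⟨a, ha, hae⟩ := HenselianRing.is_henselian f hf e ((heval e).symm ▸ he) hunit
  exact ⟨a, sub_eq_zero.mp ((heval a).symm.trans ha), hae⟩

theorem isUnit_or_isNilpotent_of_isArtinianRing {D : Type*} [CommRing D] [IsArtinianRing D]
    (hD : ∀ e : D, IsIdempotentElem e → e = 0 ∨ e = 1) (f : D) : IsUnit f ∨ IsNilpotent f := by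
  obtain ⟨n, y, hy⟩ := IsArtinian.exists_pow_succ_smul_dvd f (1 : D)
  simp only [smul_eq_mul, mul_one] at hy
  have hpow (k : ℕ) : f ^ n * (f * y) ^ k = f ^ n := by
    induction k with
    | zero => rw [pow_zero, mul_one]
    | succ k ih => rw [pow_succ (f * y), ← mul_assoc, ih, ← mul_assoc, ← pow_succ, hy]
  have hidem : IsIdempotentElem ((f * y) ^ (n + 1)) := by
    unfold IsIdempotentElem
    linear_combination f * y ^ (n + 1) * hpow (n + 1)
  rcases hD _ hidem with h0 | h1
  · exact Or.inr ⟨n, by rw [← hpow (n + 1), h0, mul_zero]⟩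
  · exact Or.inl (isUnit_of_mul_isUnit_left (IsUnit.of_pow_eq_one h1 n.succ_ne_zero))

theorem isLocalRing_of_henselianRing {C : Type*} [CommRing C] [Nontrivial C] (I : Ideal C)
    [HenselianRing C I] [IsArtinianRing (C ⧸ I)]
    (hC : ∀ e : C, IsIdempotentElem e → e = 0 ∨ e = 1) : IsLocalRing C := by
  have := isLocalHom_of_le_jacobson_bot I HenselianRing.jac
  have hquot (e : C ⧸ I) (he : IsIdempotentElem e) : e = 0 ∨ e = 1 := by
    obtain ⟨e, rfl⟩ := Ideal.Quotient.mk_surjective e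
    obtain ⟨e', he', hee'⟩ := exists_isIdempotentElem_sub_mem I (e := e)
      (by rwa [← Ideal.Quotient.mk_eq_mk_iff_sub_mem, map_mul])
    rw [← (Ideal.Quotient.mk_eq_mk_iff_sub_mem _ _).mpr hee']
    exact (hC e' he').imp (fun h => by rw [h, map_zero]) fun h => by rw [h, map_one]
  refine IsLocalRing.of_isUnit_or_isUnit_one_sub_self fun a => ?_
  refine (isUnit_or_isNilpotent_of_isArtinianRing hquot (Ideal.Quotient.mk I a)).imp
    (fun h => isUnit_of_map_unit _ _ h) fun h => isUnit_of_map_unit (Ideal.Quotient.mk I) _ ?_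
  rw [map_sub, map_one]
  exact h.isUnit_one_sub

theorem IsIndecomposable.eq_zero_or_eq_one {B L : Type*} [Ring B] [AddCommGroup L] [Module B L]
    (hL : IsIndecomposable B L) {e : Module.End B L} (he : IsIdempotentElem e) :
    e = 0 ∨ e = 1 := by
  refine (hL.2 _ _ (LinearMap.IsIdempotentElem.isCompl he)).imp LinearMap.range_eq_bot.mp
    fun h => LinearMap.ext fun x => ?_
  have hx : e (x - e x) = 0 := by rw [map_sub, ← Module.End.mul_apply, he.eq, sub_self]
  exact (sub_eq_zero.mp (LinearMap.ker_eq_bot'.mp h _ hx)).symm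

theorem IsIndecomposable.isLocalRing_end {B L : Type*} [CommRing B] [IsNoetherianRing B]
    [IsLocalRing B] [IsAdicComplete (IsLocalRing.maximalIdeal B) B] [AddCommGroup L]
    [Module B L] [Module.Finite B L] (hL : IsIndecomposable B L) :
    IsLocalRing (Module.End B L) := by
  have := hL.1
  refine ⟨fun {a b} hab => ?_⟩
  let C := Algebra.adjoin B {a}
  have : Module.Finite B C := Module.IsNoetherian.finite B (Subalgebra.toSubmodule C)
  set m := IsLocalRing.maximalIdeal B
  have : IsAdicComplete (m.map (algebraMap B C)) C :=
    (IsAdicComplete.map_algebraMap_iff _ _).mpr isAdicComplete_of_finite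
  have : IsArtinianRing (C ⧸ m.map (algebraMap B C)) := by
    let _ : Field (B ⧸ m) := Ideal.Quotient.field m
    have : Module.Finite (B ⧸ m) (C ⧸ m.map (algebraMap B C)) :=
      Module.Finite.of_restrictScalars_finite B _ _
    exact IsArtinianRing.of_finite (B ⧸ m) _
  have : IsLocalRing C := isLocalRing_of_henselianRing (m.map (algebraMap B C)) fun e he =>
    (hL.eq_zero_or_eq_one (congrArg Subtype.val he)).imp (Subtype.ext ·) (Subtype.ext ·)
  let f : C := ⟨a, Algebra.subset_adjoin rfl⟩
  rw [show b = C.subtype (1 - f) from (sub_eq_of_eq_add' hab.symm).symm]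
  exact (IsLocalRing.isUnit_or_isUnit_one_sub_self f).imp (·.map C.subtype) (·.map C.subtype)

/-! ### Radical factors under base change -/

section SmulJacobson

variable {A Q : Type*} [CommRing A] [AddCommGroup Q] [Module A Q] {r : A}

theorem homTopMk_smul_eq_zero {X : Type*} [AddCommGroup X] [Module A X]
    (hr : r • (1 : Module.End A Q) ∈ Ring.jacobson (Module.End A Q))
    (h : Q →ₗ[A] X) : homTopMk A Q X (r • h) = 0 := by
  have hcomp : r • h = h ∘ₗ (r • (1 : Module.End A Q)) := by
    rw [LinearMap.comp_smul, Module.End.one_eq_id, LinearMap.comp_id]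
  rw [hcomp, homTopMk_comp_eq_zero hr]

variable [Module.Finite A Q]

theorem isUnit_one_add_smul (hr : r ∈ Ideal.jacobson (⊥ : Ideal A)) (s : Module.End A Q) :
    IsUnit (1 + r • s) := by
  have hsurj : Function.Surjective (1 + r • s : Module.End A Q) := by
    rw [← LinearMap.range_eq_top, ← top_le_iff]
    refine Submodule.le_of_le_smul_of_le_jacobson_bot Module.Finite.fg_top
      ((Ideal.span_singleton_le_iff_mem _).mpr hr) fun c _ => ?_
    have hc : c = (1 + r • s : Module.End A Q) c - r • s c := (add_sub_cancel_right _ _).symm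
    rw [hc]
    exact Submodule.sub_mem_sup ⟨c, rfl⟩
      (Submodule.smul_mem_smul (Ideal.mem_span_singleton_self r) trivial)
  exact (Module.End.isUnit_iff _).mpr
    ⟨OrzechProperty.injective_of_surjective_endomorphism _ hsurj, hsurj⟩

theorem smul_mem_jacobson (hr : r ∈ Ideal.jacobson (⊥ : Ideal A)) (s : Module.End A Q) :
    r • s ∈ Ring.jacobson (Module.End A Q) :=
  mem_jacobson_iff_isUnit.mpr fun y => by
    rw [mul_smul_comm]
    exact isUnit_one_add_smul hr _

end SmulJacobson

section Comparison

variable {R B : Type*} [CommRing R] [CommRing B] [Algebra R B]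
  {M X : Type*} [AddCommGroup M] [Module R M] [Module.FinitePresentation R M]
  [AddCommGroup X] [Module R X] {r : R}

theorem exists_eq_baseChange_add_smul [Module.Flat R B]
    (hr : ∀ b : B, ∃ (ρ : R) (b' : B), b = algebraMap R B ρ + r • b')
    (h : B ⊗[R] M →ₗ[B] B ⊗[R] X) :
    ∃ (h₀ : M →ₗ[R] X) (h' : B ⊗[R] M →ₗ[B] B ⊗[R] X),
      h = h₀.baseChange B + algebraMap R B r • h' := by
  obtain ⟨h₀, k, hk⟩ := exists_add_smul_of_isBaseChange
    (isBaseChange_compRight (A := M) (TensorProduct.isBaseChange R X B)) hr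
    (h.restrictScalars R ∘ₗ TensorProduct.mk R B M 1)
  refine ⟨h₀, k.liftBaseChange B, TensorProduct.AlgebraTensorModule.curry_injective ?_⟩
  ext m
  simpa using LinearMap.congr_fun hk m

variable [Module.FaithfullyFlat R B]

theorem exists_eq_smul_of_baseChange_eq_smul {h : M →ₗ[R] X} {z : B ⊗[R] M →ₗ[B] B ⊗[R] X}
    (hz : h.baseChange B = algebraMap R B r • z) : ∃ k : M →ₗ[R] X, h = r • k := by
  refine exists_eq_smul_of_isBaseChange (z := z.restrictScalars R ∘ₗ TensorProduct.mk R B M 1)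
    (isBaseChange_compRight (A := M) (TensorProduct.isBaseChange R X B)) ?_
  ext m
  simpa using LinearMap.congr_fun hz (1 ⊗ₜ m)

variable (hr : ∀ b : B, ∃ (ρ : R) (b' : B), b = algebraMap R B ρ + r • b')
  (hrB : algebraMap R B r ∈ Ideal.jacobson (⊥ : Ideal B))

include hr hrB

theorem baseChange_mem_jacobson_iff {t : Module.End R M} :
    t.baseChange B ∈ Ring.jacobson (Module.End B (B ⊗[R] M)) ↔
      t ∈ Ring.jacobson (Module.End R M) := by
  have hbc (s : Module.End R M) : (1 + s * t).baseChange B = 1 + s.baseChange B * t.baseChange B :=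
    by rw [LinearMap.baseChange_add, LinearMap.baseChange_mul, LinearMap.baseChange_one]
  rw [mem_jacobson_iff_isUnit, mem_jacobson_iff_isUnit]
  constructor
  · intro h s
    have hs := h (s.baseChange B)
    rw [← hbc, Module.End.isUnit_iff] at hs
    have hsurj : Function.Surjective (1 + s * t : Module.End R M) :=
      (Module.FaithfullyFlat.lTensor_surjective_iff_surjective R B _).mp hs.2
    exact (Module.End.isUnit_iff _).mpr
      ⟨OrzechProperty.injective_of_surjective_endomorphism _ hsurj, hsurj⟩
  · intro h y
    obtain ⟨s, y', rfl⟩ := exists_eq_baseChange_add_smul hr y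
    obtain ⟨u, hu⟩ : IsUnit ((1 + s * t).baseChange B) :=
      (h s).map (Module.End.baseChangeHom R B M)
    have hfactor : 1 + (s.baseChange B + algebraMap R B r • y') * t.baseChange B =
        u * (1 + algebraMap R B r • (↑u⁻¹ * (y' * t.baseChange B))) := by
      rw [mul_add, mul_one, mul_smul_comm, Units.mul_inv_cancel_left, hu, hbc, add_mul,
        smul_mul_assoc, add_assoc]
    rw [hfactor]
    exact u.isUnit.mul (isUnit_one_add_smul hrB _)

theorem exists_eq_baseChange_add_smul_of_homTopMk_eq_zero {z : B ⊗[R] M →ₗ[B] B ⊗[R] X}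
    (hz : homTopMk B (B ⊗[R] M) (B ⊗[R] X) z = 0) :
    ∃ h₀ : M →ₗ[R] X, homTopMk R M X h₀ = 0 ∧
      ∃ z' : B ⊗[R] M →ₗ[B] B ⊗[R] X, z = h₀.baseChange B + algebraMap R B r • z' := by
  have hz_mem := (Submodule.Quotient.mk_eq_zero _).mp hz
  induction hz_mem using Submodule.smul_induction_on' with
  | smul c hc p _ =>
    obtain ⟨j, rfl⟩ := MulOpposite.op_surjective c
    rw [op_mem_jacobson_iff] at hc
    obtain ⟨p₀, p', hp⟩ := exists_eq_baseChange_add_smul hr (p : B ⊗[R] M →ₗ[B] B ⊗[R] X)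
    obtain ⟨t, j', hj⟩ := exists_eq_baseChange_add_smul hr j
    have ht : t ∈ Ring.jacobson (Module.End R M) := by
      have hsub : t.baseChange B = j - algebraMap R B r • j' :=
        eq_sub_of_add_eq (G := Module.End B (B ⊗[R] M)) hj.symm
      rw [← baseChange_mem_jacobson_iff hr hrB, hsub]
      exact sub_mem hc (smul_mem_jacobson hrB j')
    refine ⟨p₀ ∘ₗ t, homTopMk_comp_eq_zero ht p₀, p₀.baseChange B ∘ₗ j' + p' ∘ₗ j, ?_⟩
    calc (p : B ⊗[R] M →ₗ[B] B ⊗[R] X) ∘ₗ j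
        = p₀.baseChange B ∘ₗ j + algebraMap R B r • p' ∘ₗ j := by
          rw [hp, LinearMap.add_comp, LinearMap.smul_comp]
      _ = p₀.baseChange B ∘ₗ (t.baseChange B + algebraMap R B r • j') +
            algebraMap R B r • p' ∘ₗ j := by rw [← hj]
      _ = (p₀ ∘ₗ t).baseChange B + algebraMap R B r • (p₀.baseChange B ∘ₗ j' + p' ∘ₗ j) := by
          rw [LinearMap.comp_add, LinearMap.comp_smul, smul_add, LinearMap.baseChange_comp,
            add_assoc]
  | add x hx y hy ihx ihy =>
    obtain ⟨h₁, hh₁, z₁, e₁⟩ := ihx ((Submodule.Quotient.mk_eq_zero _).mpr hx)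
    obtain ⟨h₂, hh₂, z₂, e₂⟩ := ihy ((Submodule.Quotient.mk_eq_zero _).mpr hy)
    refine ⟨h₁ + h₂, by rw [map_add, hh₁, hh₂, add_zero], z₁ + z₂, ?_⟩
    calc (x : B ⊗[R] M →ₗ[B] B ⊗[R] X) + (y : B ⊗[R] M →ₗ[B] B ⊗[R] X)
        = (h₁.baseChange B + algebraMap R B r • z₁) +
            (h₂.baseChange B + algebraMap R B r • z₂) := by rw [← e₁, ← e₂]
      _ = (h₁ + h₂).baseChange B + algebraMap R B r • (z₁ + z₂) := by
          rw [LinearMap.baseChange_add, smul_add, add_add_add_comm]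

theorem homTopMk_baseChange_eq_zero_iff {h : M →ₗ[R] X} :
    homTopMk B (B ⊗[R] M) (B ⊗[R] X) (h.baseChange B) = 0 ↔ homTopMk R M X h = 0 := by
  constructor
  · intro hh
    obtain ⟨h₀, hh₀, z, hz⟩ := exists_eq_baseChange_add_smul_of_homTopMk_eq_zero hr hrB hh
    obtain ⟨k, hk⟩ : ∃ k : M →ₗ[R] X, h - h₀ = r • k :=
      exists_eq_smul_of_baseChange_eq_smul (B := B) (z := z) <|
        (LinearMap.baseChange_sub _ _).trans
          (sub_eq_of_eq_add' (G := B ⊗[R] M →ₗ[B] B ⊗[R] X) hz)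
    have hr_one : r • (1 : Module.End R M) ∈ Ring.jacobson (Module.End R M) := by
      rw [← baseChange_mem_jacobson_iff hr hrB, LinearMap.baseChange_smul,
        LinearMap.baseChange_one, ← algebraMap_smul B r]
      exact smul_mem_jacobson hrB 1
    rw [← sub_add_cancel h h₀, hk, map_add, hh₀, homTopMk_smul_eq_zero hr_one, add_zero]
  · intro hh
    have hh_mem := (Submodule.Quotient.mk_eq_zero _).mp hh
    induction hh_mem using Submodule.smul_induction_on' with
    | smul c hc p _ =>
      obtain ⟨j, rfl⟩ := MulOpposite.op_surjective c
      rw [op_mem_jacobson_iff, ← baseChange_mem_jacobson_iff hr hrB] at hc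
      have hcomp : LinearMap.baseChange B ((p : M →ₗ[R] X) ∘ₗ j) =
          (p : M →ₗ[R] X).baseChange B ∘ₗ j.baseChange B := LinearMap.baseChange_comp _ _
      exact (congrArg _ hcomp).trans (homTopMk_comp_eq_zero hc _)
    | add x hx y hy ihx ihy =>
      have hadd : LinearMap.baseChange B ((x : M →ₗ[R] X) + (y : M →ₗ[R] X)) =
          (x : M →ₗ[R] X).baseChange B + (y : M →ₗ[R] X).baseChange B :=
        LinearMap.baseChange_add _ _
      refine (congrArg _ hadd).trans ?_
      rw [map_add, ihx ((Submodule.Quotient.mk_eq_zero _).mpr hx),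
        ihy ((Submodule.Quotient.mk_eq_zero _).mpr hy), add_zero]

end Comparison

section ComparisonCompletion

variable {R : Type u} [CommRing R] [IsNoetherianRing R] [IsLocalRing R]

theorem algebraMap_mem_jacobson_completion {r : R} (hr : r ∈ IsLocalRing.maximalIdeal R) :
    algebraMap R (RHat R) r ∈ Ideal.jacobson (⊥ : Ideal (RHat R)) :=
  IsLocalRing.maximalIdeal_le_jacobson _ (algebraMap_mem_maximalIdeal_completion hr)

variable [IsDomain R] {M : Type v} [AddCommGroup M] [Module R M] [Module.Finite R M]
  {X : Type w} [AddCommGroup X] [Module R X]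

theorem endDense_of_finite (hdim : ringKrullDim R = 1) : EndDense R M := by
  have := Module.finitePresentation_of_finite R M
  obtain ⟨r, hrm, hr⟩ := exists_mem_maximalIdeal_ne_zero hdim
  intro s
  obtain ⟨t, s', hs⟩ := exists_eq_baseChange_add_smul (exists_algebraMap_add_smul hdim hr) s.unop
  refine ⟨MulOpposite.op t, ?_⟩
  have hsub : s - endToCompl R M (MulOpposite.op t) =
      MulOpposite.op (algebraMap R (RHat R) r • s') :=
    MulOpposite.unop_injective (sub_eq_of_eq_add' hs)
  rw [hsub, op_mem_jacobson_iff]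
  exact smul_mem_jacobson (algebraMap_mem_jacobson_completion hrm) s'

variable (R M X) in
/-- Base change of homomorphisms to the completion, followed by the projection to the radical
factor. -/
def baseChangeTop : HomMod R M X →ₗ[(Module.End R M)ᵐᵒᵖ] SimpleMod R M (RHat R ⊗[R] X) where
  toFun h := toSimpleMod R M _ (homTopMk (RHat R) (MHat R M) (RHat R ⊗[R] X)
    ((h : M →ₗ[R] X).baseChange (RHat R)))
  map_add' g h := by
    have hadd : LinearMap.baseChange (RHat R) ((g : M →ₗ[R] X) + (h : M →ₗ[R] X)) = _ :=
      LinearMap.baseChange_add _ _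
    exact (congrArg (homTopMk (RHat R) (MHat R M) (RHat R ⊗[R] X)) hadd).trans (map_add _ _ _)
  map_smul' c h := by
    have hcomp : LinearMap.baseChange (RHat R) ((h : M →ₗ[R] X) ∘ₗ c.unop) = _ :=
      LinearMap.baseChange_comp _ _
    exact congrArg (homTopMk (RHat R) (MHat R M) (RHat R ⊗[R] X)) hcomp

theorem baseChangeTop_surjective (hdim : ringKrullDim R = 1) :
    Function.Surjective (baseChangeTop R M X) := by
  have := Module.finitePresentation_of_finite R M
  obtain ⟨r, hrm, hr⟩ := exists_mem_maximalIdeal_ne_zero hdim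
  intro y
  obtain ⟨h, hh⟩ := homTopMk_surjective ((toSimpleMod R M _).symm y)
  obtain ⟨h₀, h', rfl⟩ := exists_eq_baseChange_add_smul (exists_algebraMap_add_smul hdim hr) h
  rw [map_add, homTopMk_smul_eq_zero
    (smul_mem_jacobson (algebraMap_mem_jacobson_completion hrm) 1), add_zero] at hh
  exact ⟨h₀, (toSimpleMod R M _).symm.injective hh⟩

theorem ker_baseChangeTop (hdim : ringKrullDim R = 1) :
    LinearMap.ker (baseChangeTop R M X) =
      Ring.jacobson (Module.End R M)ᵐᵒᵖ • (⊤ : Submodule (Module.End R M)ᵐᵒᵖ (HomMod R M X)) := by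
  have := Module.finitePresentation_of_finite R M
  obtain ⟨r, hrm, hr⟩ := exists_mem_maximalIdeal_ne_zero hdim
  ext h
  exact (homTopMk_baseChange_eq_zero_iff (exists_algebraMap_add_smul hdim hr)
    (algebraMap_mem_jacobson_completion hrm)).trans (Submodule.Quotient.mk_eq_zero _)

theorem nonempty_homTop_linearEquiv (hdim : ringKrullDim R = 1) :
    Nonempty (HomTop R M X ≃ₗ[(Module.End R M)ᵐᵒᵖ] SimpleMod R M (RHat R ⊗[R] X)) :=
  ⟨(Submodule.quotEquivOfEq _ _ (ker_baseChangeTop hdim).symm).trans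
    ((baseChangeTop R M X).quotKerEquivOfSurjective (baseChangeTop_surjective hdim))⟩

end ComparisonCompletion

/-! ### Extending homomorphisms up to denominators -/

section Extension

variable {B Y C : Type*} [CommRing B] [AddCommGroup Y] [Module B Y] [AddCommGroup C] [Module B C]

theorem isField_localization_of_mem_minimalPrimes [IsReduced B] {P : Ideal B} [P.IsPrime]
    (hP : P ∈ minimalPrimes B) : IsField (Localization.AtPrime P) := by
  have : Ring.KrullDimLE 0 (Localization.AtPrime P) := .of_isLocalization _ hP _
  have : IsReduced (Localization.AtPrime P) :=
    isReduced_localizationPreserves P.primeCompl (Localization.AtPrime P) ‹_›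
  exact Ring.KrullDimLE.isField_of_isReduced

theorem exists_comp_eq_smul_of_isField_localization [Module.Finite B Y]
    [Module.FinitePresentation B C] {P : Ideal B} [P.IsPrime]
    (hP : IsField (Localization.AtPrime P)) {f : Y →ₗ[B] C} (hf : Function.Injective f) :
    ∃ b ∉ P, ∃ ρ : C →ₗ[B] Y, ρ ∘ₗ f = b • LinearMap.id := by
  let K := Localization.AtPrime P
  let _ : Field K := hP.toField
  let ℓ := TensorProduct.mk B K Y 1
  obtain ⟨g, hg⟩ := (f.baseChange K).exists_leftInverse_of_injective <| LinearMap.ker_eq_bot.mpr <|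
    Module.Flat.lTensor_preserves_injective_linearMap (M := K) f hf
  obtain ⟨h, s, hs⟩ := Module.FinitePresentation.exists_lift_of_isLocalizedModule P.primeCompl ℓ
    (g.restrictScalars B ∘ₗ TensorProduct.mk B K C 1)
  have hℓ : ℓ ∘ₗ h ∘ₗ f = ℓ ∘ₗ ((s : B) • LinearMap.id) := LinearMap.ext fun y => calc
    ℓ (h (f y)) = s.1 • g (1 ⊗ₜ f y) := LinearMap.congr_fun hs (f y)
    _ = s.1 • ℓ y := congrArg _ (LinearMap.congr_fun hg (1 ⊗ₜ y))
    _ = ℓ (s.1 • y) := (map_smul ℓ _ y).symm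
  obtain ⟨t, ht⟩ := Module.Finite.exists_smul_of_comp_eq_of_isLocalizedModule P.primeCompl ℓ
    (h ∘ₗ f) ((s : B) • LinearMap.id) hℓ
  refine ⟨t * s, (t * s).2, (t : B) • h, ?_⟩
  rw [LinearMap.smul_comp, mul_smul]
  exact ht

theorem exists_comp_eq_pow_smul [IsNoetherianRing B] [IsLocalRing B] [IsReduced B]
    [Module.Finite B C] {r : B} {n : ℕ} (hn : IsLocalRing.maximalIdeal B ^ n ≤ Ideal.span {r})
    (hr : r ∈ IsLocalRing.maximalIdeal B) {f : Y →ₗ[B] C} (hf : Function.Injective f) :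
    ∃ (t : ℕ) (ρ : C →ₗ[B] Y), ρ ∘ₗ f = r ^ t • LinearMap.id := by
  have : Module.Finite B Y := Module.Finite.of_injective f hf
  have := Module.finitePresentation_of_finite B C
  let I : Ideal B :=
    { carrier := {b | ∃ ρ : C →ₗ[B] Y, ρ ∘ₗ f = b • LinearMap.id}
      zero_mem' := ⟨0, by rw [LinearMap.zero_comp, zero_smul]⟩
      add_mem' := by
        rintro a b ⟨ρ, hρ⟩ ⟨ρ', hρ'⟩
        exact ⟨ρ + ρ', by rw [LinearMap.add_comp, hρ, hρ', add_smul]⟩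
      smul_mem' := by
        rintro c a ⟨ρ, hρ⟩
        exact ⟨c • ρ, by rw [LinearMap.smul_comp, hρ, smul_smul, smul_eq_mul]⟩ }
  refine exists_pow_mem_of_forall_not_le (I := I) hn hr fun P hP hle => ?_
  have := hP.1.1
  obtain ⟨b, hb, hρ⟩ :=
    exists_comp_eq_smul_of_isField_localization (isField_localization_of_mem_minimalPrimes hP) hf
  exact hb (hle hρ)

theorem injective_comp_equiv_lTensor_subtype {R X N : Type*} [CommRing R] [Algebra R B]
    [Module.Flat R B] [AddCommGroup X] [Module R X] [AddCommGroup N] [Module R N] [Module B N]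
    [IsScalarTower R B N] {ε : X →ₗ[R] N} (hε : IsBaseChange B ε) {A : Submodule R X}
    {ι : C →ₗ[B] N} {κ : N →ₗ[B] C} (hA : ∀ x ∈ A, ι (κ (ε x)) = ε x) :
    Function.Injective (κ ∘ₗ hε.equiv.toLinearMap ∘ₗ A.subtype.baseChange B) := by
  have hret (z : B ⊗[R] A) :
      ι (κ (hε.equiv (A.subtype.baseChange B z))) = hε.equiv (A.subtype.baseChange B z) := by
    induction z with
    | zero => simp only [map_zero]
    | add x y hx hy => simp only [map_add, hx, hy]
    | tmul b a => simp only [LinearMap.baseChange_tmul, IsBaseChange.equiv_tmul, map_smul,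
        Submodule.subtype_apply, hA a a.2]
  have hinj : Function.Injective (A.subtype.baseChange B) :=
    Module.Flat.lTensor_preserves_injective_linearMap A.subtype Subtype.val_injective
  refine Function.Injective.of_comp (f := ι) ?_
  have hcomp : ι ∘ (κ ∘ₗ hε.equiv.toLinearMap ∘ₗ A.subtype.baseChange B) =
      hε.equiv ∘ A.subtype.baseChange B := funext hret
  rw [hcomp]
  exact hε.equiv.injective.comp hinj

theorem exists_pow_smul_extension {R X N Gc : Type*} [CommRing R] [Algebra R B] [Module.Flat R B]
    [IsNoetherianRing B] [IsLocalRing B] [IsReduced B] {r : R} {n : ℕ}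
    (hn : IsLocalRing.maximalIdeal B ^ n ≤ Ideal.span {algebraMap R B r})
    (hr : algebraMap R B r ∈ IsLocalRing.maximalIdeal B)
    [AddCommGroup X] [Module R X] [AddCommGroup N] [Module R N] [Module B N] [IsScalarTower R B N]
    {ε : X →ₗ[R] N} (hε : IsBaseChange B ε) {A : Submodule R X} [Module.Finite B C]
    {ι : C →ₗ[B] N} {κ : N →ₗ[B] C} (hA : ∀ x ∈ A, ι (κ (ε x)) = ε x)
    [AddCommGroup Gc] [Module R Gc] [Module B Gc] [IsScalarTower R B Gc] :
    ∃ t : ℕ, ∀ ψ : A →ₗ[R] Gc, ∃ Ψ : N →ₗ[B] Gc, ∀ a : A, Ψ (ε a) = r ^ t • ψ a := by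
  obtain ⟨t, ρ, hρ⟩ := exists_comp_eq_pow_smul hn hr (injective_comp_equiv_lTensor_subtype hε hA)
  refine ⟨t, fun ψ => ⟨ψ.liftBaseChange B ∘ₗ ρ ∘ₗ κ, fun a => ?_⟩⟩
  have hρa : ρ (κ (ε a)) = algebraMap R B r ^ t • (1 ⊗ₜ a) := by
    rw [← one_smul B (ε a), ← hε.equiv_tmul]
    exact LinearMap.congr_fun hρ (1 ⊗ₜ a)
  rw [LinearMap.comp_apply, LinearMap.comp_apply, hρa, map_smul, LinearMap.liftBaseChange_tmul,
    one_smul, ← map_pow, algebraMap_smul]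

end Extension

/-! ### Lattices in modules of constant rank -/

section ConstantRank

variable {B : Type u} [CommRing B] {N : Type w'} [AddCommGroup N] [Module B N] {κ : Type w}

instance isPrime_coe_minimalPrimes (P : minimalPrimes B) : P.1.IsPrime := P.2.1.1

/-- The family `v` of elements of `N` becomes a basis after localization at the prime `P`. -/
def IsBasisAt (P : Ideal B) [P.IsPrime] (v : κ → N) : Prop :=
  ∃ b : Module.Basis κ (Localization.AtPrime P) (Localization.AtPrime P ⊗[B] N),
    ∀ i, b i = 1 ⊗ₜ v i

theorem exists_smul_eq_of_mem_span_localization (P : Ideal B) [hP : P.IsPrime]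
    (W : Submodule B N) {z : Localization.AtPrime P ⊗[B] N}
    (hz : z ∈ Submodule.span (Localization.AtPrime P)
      (TensorProduct.mk B (Localization.AtPrime P) N 1 '' W)) :
    ∃ b ∉ P, ∃ w ∈ W, b • z = 1 ⊗ₜ w := by
  induction hz using Submodule.span_induction with
  | mem z hz =>
    obtain ⟨w, hw, rfl⟩ := hz
    exact ⟨1, hP.one_notMem, w, hw, one_smul _ _⟩
  | zero => exact ⟨1, hP.one_notMem, 0, zero_mem _, by simp⟩
  | add x y _ _ hx hy =>
    obtain ⟨b, hb, w, hw, hbx⟩ := hx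
    obtain ⟨c, hc, w', hw', hcy⟩ := hy
    refine ⟨b * c, hP.mul_notMem hb hc, c • w + b • w',
      add_mem (W.smul_mem _ hw) (W.smul_mem _ hw'), ?_⟩
    rw [smul_add, mul_smul b c y, hcy, mul_comm, mul_smul, hbx, TensorProduct.tmul_add,
      TensorProduct.tmul_smul, TensorProduct.tmul_smul]
  | smul a x _ hx =>
    obtain ⟨b, hb, w, hw, hbx⟩ := hx
    obtain ⟨⟨c, s⟩, hs⟩ := IsLocalization.surj P.primeCompl a
    refine ⟨s * b, hP.mul_notMem s.2 hb, c • w, W.smul_mem _ hw, ?_⟩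
    have hsa : (s : B) • a = algebraMap B _ c := by rw [← hs, Algebra.smul_def, mul_comm]
    rw [mul_smul, smul_comm b a x, hbx, ← smul_assoc, hsa, algebraMap_smul,
      TensorProduct.tmul_smul]

theorem IsBasisAt.exists_smul_mem_span {P : Ideal B} [hP : P.IsPrime] {v : κ → N}
    (hv : IsBasisAt P v) (n : N) : ∃ b ∉ P, b • n ∈ Submodule.span B (Set.range v) := by
  obtain ⟨bv, hbv⟩ := hv
  have hspan : (1 : Localization.AtPrime P) ⊗ₜ[B] n ∈ Submodule.span (Localization.AtPrime P)
      (TensorProduct.mk B (Localization.AtPrime P) N 1 '' Submodule.span B (Set.range v)) := by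
    refine Submodule.span_mono ?_ (bv.mem_span (1 ⊗ₜ[B] n))
    rintro _ ⟨t, rfl⟩
    exact ⟨v t, Submodule.subset_span ⟨t, rfl⟩, (hbv t).symm⟩
  obtain ⟨c, hc, y, hy, hcn⟩ := exists_smul_eq_of_mem_span_localization P _ hspan
  have hcy : TensorProduct.mk B (Localization.AtPrime P) N 1 (c • n) =
      TensorProduct.mk B (Localization.AtPrime P) N 1 y := by
    rw [map_smul]
    exact hcn
  obtain ⟨d, hd⟩ := IsLocalizedModule.exists_of_eq (S := P.primeCompl) hcy
  refine ⟨d * c, hP.mul_notMem d.2 hc, ?_⟩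
  rw [mul_smul, show (d : B) • c • n = (d : B) • y from hd]
  exact Submodule.smul_mem _ _ hy

theorem IsBasisAt.mem_of_linearCombination_eq_zero {P : Ideal B} [P.IsPrime] {v : κ → N}
    (hv : IsBasisAt P v) {c : κ →₀ B} (hc : Finsupp.linearCombination B v c = 0) (t : κ) :
    c t ∈ P := by
  obtain ⟨b, hb⟩ := hv
  have hsum : ∑ i ∈ c.support, algebraMap B (Localization.AtPrime P) (c i) • b i = 0 := by
    simp only [hb, algebraMap_smul, ← TensorProduct.tmul_smul, ← TensorProduct.tmul_sum]
    rw [show ∑ i ∈ c.support, c i • v i = 0 from hc, TensorProduct.tmul_zero]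
  by_cases ht : t ∈ c.support
  · by_contra hct
    exact (IsLocalization.AtPrime.isUnit_to_map_iff _ P (c t)).mpr hct |>.ne_zero
      (linearIndependent_iff'.mp b.linearIndependent _ _ hsum t ht)
  · rw [Finsupp.notMem_support_iff.mp ht]
    exact zero_mem _

theorem linearIndependent_of_isBasisAt [IsReduced B] {v : κ → N}
    (hv : ∀ P : minimalPrimes B, IsBasisAt P.1 v) : LinearIndependent B v := by
  refine linearIndependent_iff.mpr fun c hc => Finsupp.ext fun t => ?_
  have hbot : sInf (minimalPrimes B) = ⊥ :=
    (Ideal.sInf_minimalPrimes (I := (⊥ : Ideal B))).trans (Ideal.radical_bot_of_isReduced)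
  have hmem : c t ∈ sInf (minimalPrimes B) :=
    Ideal.mem_sInf.mpr fun {P} hP =>
      have : P.IsPrime := hP.1.1
      (hv ⟨P, hP⟩ : IsBasisAt P v).mem_of_linearCombination_eq_zero hc t
  rwa [hbot] at hmem

theorem exists_mem_forall_ne_notMem [IsNoetherianRing B] (P : minimalPrimes B) :
    ∃ e : B, e ∉ P.1 ∧ ∀ Q : minimalPrimes B, Q ≠ P → e ∈ Q.1 := by
  classical
  have := (minimalPrimes.finite_of_isNoetherianRing B).fintype
  have hsep : ∀ Q : minimalPrimes B, ∃ e : B, e ∉ P.1 ∧ (Q ≠ P → e ∈ Q.1) := fun Q => by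
    by_cases hQ : Q = P
    · exact ⟨1, P.2.1.1.one_notMem, fun hne => absurd hQ hne⟩
    · have hle : ¬ Q.1 ≤ P.1 := fun hle =>
        hQ (Subtype.ext (le_antisymm hle (P.2.2 Q.2.1 hle)))
      obtain ⟨e, heQ, heP⟩ := Set.not_subset.mp hle
      exact ⟨e, heP, fun _ => heQ⟩
  choose e heP heQ using hsep
  refine ⟨∏ Q, e Q, fun hmem => ?_, fun Q hQ =>
    Ideal.mem_of_dvd _ (Finset.dvd_prod_of_mem e (Finset.mem_univ Q)) (heQ Q hQ)⟩
  obtain ⟨Q, -, hQ⟩ := Ideal.IsPrime.prod_mem_iff.mp hmem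
  exact heP Q hQ

theorem algebraMap_localization_eq_zero [IsReduced B] {P : Ideal B} [P.IsPrime]
    (hP : P ∈ minimalPrimes B) {b : B} (hb : b ∈ P) :
    algebraMap B (Localization.AtPrime P) b = 0 := by
  let _ := (isField_localization_of_mem_minimalPrimes hP).toField
  by_contra hne
  exact (IsLocalization.AtPrime.isUnit_to_map_iff _ P b).mp (Ne.isUnit hne) hb

theorem exists_forall_isBasisAt [IsNoetherianRing B] [IsReduced B]
    {n : minimalPrimes B → κ → N} (hn : ∀ P, IsBasisAt P.1 (n P)) :
    ∃ v : κ → N, ∀ P : minimalPrimes B, IsBasisAt P.1 v := by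
  classical
  have := (minimalPrimes.finite_of_isNoetherianRing B).fintype
  choose e heP heQ using exists_mem_forall_ne_notMem (B := B)
  refine ⟨fun t => ∑ P, e P • n P t, fun Q => ?_⟩
  obtain ⟨b, hb⟩ := hn Q
  have hunit : IsUnit (algebraMap B (Localization.AtPrime Q.1) (e Q)) :=
    (IsLocalization.AtPrime.isUnit_to_map_iff _ Q.1 _).mpr (heP Q)
  refine ⟨b.isUnitSMul fun _ => hunit, fun t => ?_⟩
  have htmul : ∀ P, (1 : Localization.AtPrime Q.1) ⊗ₜ[B] (e P • n P t) =
      algebraMap B (Localization.AtPrime Q.1) (e P) • 1 ⊗ₜ[B] n P t := fun P => by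
    rw [TensorProduct.tmul_smul, algebraMap_smul]
  have hzero : ∀ P ≠ Q, (1 : Localization.AtPrime Q.1) ⊗ₜ[B] (e P • n P t) = 0 :=
    fun P hP => by
      rw [htmul, algebraMap_localization_eq_zero Q.2 (heQ P Q hP.symm), zero_smul]
  rw [Module.Basis.isUnitSMul_apply, TensorProduct.tmul_sum,
    Fintype.sum_eq_single Q hzero, htmul, hb]

theorem exists_basis_baseChange {K : Type*} [Field K] [Algebra B K] {S : Set N}
    (hS : Submodule.span B S = ⊤) :
    ∃ T ⊆ S, ∃ b : Module.Basis T K (K ⊗[B] N), ∀ x, b x = 1 ⊗ₜ (x : N) := by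
  obtain ⟨T, hTS, -, hST, hT⟩ := exists_linearIndepOn_extension
    (linearIndepOn_empty K (TensorProduct.mk B K N 1)) S.empty_subset
  have hspan : Submodule.span K (TensorProduct.mk B K N 1 '' S) = ⊤ := by
    rw [← Submodule.baseChange_span, hS, Submodule.baseChange_top]
  have htop : ⊤ ≤ Submodule.span K (Set.range fun x : T => TensorProduct.mk B K N 1 x) := by
    rw [← hspan, ← Set.image_eq_range]
    exact Submodule.span_le.mpr hST
  exact ⟨T, hTS, Module.Basis.mk hT htop, fun x => Module.Basis.mk_apply hT htop x⟩

theorem exists_isBasisAt_of_rank_eq [IsReduced B] [Nontrivial B]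
    (hN : IsCountablyGenerated B N)
    (hrank : ∀ P Q : minimalPrimes B,
      (Module.rank (Localization.AtPrime P.1) (Localization.AtPrime P.1 ⊗[B] N)).toENat =
        (Module.rank (Localization.AtPrime Q.1) (Localization.AtPrime Q.1 ⊗[B] N)).toENat) :
    ∃ (κ : Type w') (n : minimalPrimes B → κ → N), ∀ P, IsBasisAt P.1 (n P) := by
  obtain ⟨S, hS, hSN⟩ := hN
  have hbasis : ∀ P : minimalPrimes B, ∃ T ⊆ S, IsBasisAt P.1 ((↑) : T → N) := fun P =>
    let _ := (isField_localization_of_mem_minimalPrimes P.2).toField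
    exists_basis_baseChange (K := Localization.AtPrime P.1) hSN
  choose T hTS hT using hbasis
  have hcard : ∀ P, (Cardinal.mk (T P)).toENat =
      (Module.rank (Localization.AtPrime P.1) (Localization.AtPrime P.1 ⊗[B] N)).toENat :=
    fun P => by
      obtain ⟨b, -⟩ := hT P
      rw [← Cardinal.toENat_lift, b.mk_eq_rank, Cardinal.toENat_lift]
  have hcount : ∀ P, Cardinal.mk (T P) ≤ Cardinal.aleph0 := fun P =>
    Cardinal.le_aleph0_iff_set_countable.mpr (hS.mono (hTS P))
  obtain ⟨P₀⟩ : Nonempty (minimalPrimes B) :=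
    Ideal.nonempty_minimalPrimes (I := (⊥ : Ideal B)) bot_ne_top
  have hequiv : ∀ P, Nonempty (T P₀ ≃ T P) := fun P => Cardinal.eq.mp <|
    Cardinal.toENat_injOn (hcount P₀) (hcount P) (by rw [hcard, hcard, hrank P₀ P])
  let σ P := (hequiv P).some
  refine ⟨T P₀, fun P t => σ P t, fun P => ?_⟩
  obtain ⟨b, hb⟩ := hT P
  exact ⟨b.reindex (σ P).symm, fun i => by
    rw [Module.Basis.reindex_apply, hb, Equiv.symm_symm]⟩

end ConstantRank

section Lattice

variable {R B N : Type*} [CommRing R] [CommRing B] [Algebra R B] [AddCommGroup N] [Module R N]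
  [Module B N] [IsScalarTower R B N]

theorem exists_finset_mem_span_image {X : Type*} [AddCommGroup X] [Module R X] {ε : X →ₗ[R] N}
    (hε : IsBaseChange B ε) (n : N) : ∃ T : Finset X, n ∈ Submodule.span B (ε '' T) := by
  classical
  induction n using hε.inductionOn with
  | zero => exact ⟨∅, zero_mem _⟩
  | tmul x => exact ⟨{x}, Submodule.subset_span ⟨x, Finset.mem_singleton_self x, rfl⟩⟩
  | smul b n hn =>
    obtain ⟨T, hT⟩ := hn
    exact ⟨T, Submodule.smul_mem _ _ hT⟩
  | add m n hm hn =>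
    obtain ⟨T, hT⟩ := hm
    obtain ⟨T', hT'⟩ := hn
    refine ⟨T ∪ T', add_mem (Submodule.span_mono (Set.image_mono ?_) hT)
      (Submodule.span_mono (Set.image_mono ?_) hT')⟩
    · exact Finset.coe_subset.mpr Finset.subset_union_left
    · exact Finset.coe_subset.mpr Finset.subset_union_right

theorem isCountablyGenerated_of_isBaseChange [Module.FaithfullyFlat R B] {X : Type*}
    [AddCommGroup X] [Module R X] {ε : X →ₗ[R] N} (hε : IsBaseChange B ε)
    (hN : IsCountablyGenerated B N) : IsCountablyGenerated R X := by
  obtain ⟨S, hS, hSN⟩ := hN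
  choose T hT using exists_finset_mem_span_image hε
  refine ⟨⋃ n ∈ S, (T n : Set X), hS.biUnion fun n _ => (T n).countable_toSet, ?_⟩
  set A := Submodule.span R (⋃ n ∈ S, (T n : Set X))
  have hcomp : (ε ∘ₗ A.subtype).liftBaseChange B =
      hε.equiv.toLinearMap ∘ₗ A.subtype.baseChange B := by
    ext x
    simp [IsBaseChange.equiv_tmul]
  have hrange : LinearMap.range ((ε ∘ₗ A.subtype).liftBaseChange B) = ⊤ := by
    rw [eq_top_iff, ← hSN, Submodule.span_le]
    intro n hn
    refine Submodule.span_le.mpr ?_ (hT n)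
    rintro _ ⟨x, hx, rfl⟩
    exact ⟨1 ⊗ₜ ⟨x, Submodule.subset_span (Set.mem_biUnion hn hx)⟩, by simp⟩
  have hsurj : Function.Surjective (A.subtype.lTensor B) := by
    rw [LinearMap.range_eq_top, hcomp] at hrange
    exact Function.Surjective.of_comp_left (f := hε.equiv) hrange hε.equiv.injective
  rw [← A.range_subtype, LinearMap.range_eq_top]
  exact (Module.FaithfullyFlat.lTensor_surjective_iff_surjective R B _).mp hsurj

variable {κ : Type*} {v : κ → N}

variable (R) in
/-- The elements of `N` with a nonzero multiple in the `R`-span of the family `v`. If `v` is a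
basis of `N` at the minimal primes of a completion of `R`, this is the `R`-lattice in `N` whose
base change is `N`. -/
def saturatedSpan (v : κ → N) : Submodule R N :=
  (Submodule.torsion R (N ⧸ Submodule.span R (Set.range v))).comap (Submodule.mkQ _)

theorem mem_saturatedSpan_iff [IsDomain R] {x : N} :
    x ∈ saturatedSpan R v ↔ ∃ r : R, r ≠ 0 ∧ r • x ∈ Submodule.span R (Set.range v) := by
  simp only [saturatedSpan, Submodule.mem_comap, Submodule.mem_torsion_iff, Submonoid.smul_def,
    Submodule.mkQ_apply, ← Submodule.Quotient.mk_smul, Submodule.Quotient.mk_eq_zero,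
    Subtype.exists, mem_nonZeroDivisors_iff_ne_zero, exists_prop]

theorem mem_saturatedSpan [IsDomain R] (t : κ) : v t ∈ saturatedSpan R v :=
  mem_saturatedSpan_iff.mpr ⟨1, one_ne_zero, by
    rw [one_smul]
    exact Submodule.subset_span ⟨t, rfl⟩⟩

theorem isTorsionFree_tensorProduct [IsDomain R] [Module.Flat R B] (X : Type*) [AddCommGroup X]
    [Module R X] [Module.IsTorsionFree R X] : Module.IsTorsionFree R (B ⊗[R] X) := by
  refine ⟨fun r hr => ?_⟩
  have hinj := Module.Flat.lTensor_preserves_injective_linearMap (M := B)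
    (LinearMap.lsmul R X r) (Module.IsTorsionFree.isSMulRegular hr)
  rwa [show (LinearMap.lsmul R X r).lTensor B = LinearMap.lsmul R (B ⊗[R] X) r from
    TensorProduct.ext' fun b x => TensorProduct.tmul_smul r b x] at hinj

theorem exists_smul_mem_baseChange [IsDomain R] {X : Type*} [AddCommGroup X] [Module R X]
    {W : Submodule R X} (hW : ∀ x, ∃ r : R, r ≠ 0 ∧ r • x ∈ W) (z : B ⊗[R] X) :
    ∃ r : R, r ≠ 0 ∧ r • z ∈ W.baseChange B := by
  induction z with
  | zero => exact ⟨1, one_ne_zero, by simp⟩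
  | add x y hx hy =>
    obtain ⟨r, hr, hx⟩ := hx
    obtain ⟨t, ht, hy⟩ := hy
    refine ⟨r * t, mul_ne_zero hr ht, ?_⟩
    rw [smul_add, mul_smul r t y, mul_comm, mul_smul]
    exact add_mem (Submodule.smul_of_tower_mem _ _ hx) (Submodule.smul_of_tower_mem _ _ hy)
  | tmul b x =>
    obtain ⟨r, hr, hx⟩ := hW x
    exact ⟨r, hr, by
      rw [← TensorProduct.tmul_smul]
      exact Submodule.tmul_mem_baseChange_of_mem b hx⟩

theorem injective_liftBaseChange_saturatedSpan [IsDomain R] [Module.Flat R B]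
    [Module.IsTorsionFree R N] (hv : LinearIndependent B v) :
    Function.Injective ((saturatedSpan R v).subtype.liftBaseChange B) := by
  set f := (saturatedSpan R v).subtype.liftBaseChange B
  let w : κ → saturatedSpan R v := fun t => ⟨v t, mem_saturatedSpan t⟩
  have hW : ∀ x : saturatedSpan R v, ∃ r : R, r ≠ 0 ∧ r • x ∈ Submodule.span R (Set.range w) := by
    rintro ⟨x, hx⟩
    obtain ⟨r, hr, hrx⟩ := mem_saturatedSpan_iff.mp hx
    refine ⟨r, hr, (Submodule.injective_subtype _).mem_set_image.mp ?_⟩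
    rw [← Submodule.map_coe, Submodule.map_span, ← Set.range_comp]
    exact hrx
  have hfw : f ∘ (fun t => (1 : B) ⊗ₜ[R] w t) = v := funext fun t => by simp [f, w]
  have hdisj := Submodule.range_ker_disjoint (f := f) (hfw.symm ▸ hv)
  refine (injective_iff_map_eq_zero f).mpr fun z hz => ?_
  obtain ⟨r, hr, hrz⟩ := exists_smul_mem_baseChange (B := B) hW z
  rw [Submodule.baseChange_span, ← Set.range_comp] at hrz
  have hker : r • z ∈ LinearMap.ker f :=
    Submodule.smul_of_tower_mem _ r (LinearMap.mem_ker.mpr hz)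
  have := isTorsionFree_tensorProduct (R := R) (B := B) (saturatedSpan R v)
  exact (smul_eq_zero_iff_right hr).mp (Submodule.disjoint_def.mp hdisj _ hrz hker)

theorem mem_span_saturatedSpan [IsDomain R] {r : R} (hr : r ≠ 0)
    (hB : ∀ b : B, ∃ (ρ : R) (b' : B), b = algebraMap R B ρ + r • b') {n : N}
    (hn : r • n ∈ Submodule.span B (Set.range v)) :
    n ∈ Submodule.span B (saturatedSpan R v : Set N) := by
  obtain ⟨c, hc⟩ := Finsupp.mem_span_range_iff_exists_finsupp.mp hn
  choose ρ b' hb using hB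
  set y := ∑ t ∈ c.support, b' (c t) • v t
  have hy : y ∈ Submodule.span B (saturatedSpan R v : Set N) := sum_mem fun t _ =>
    Submodule.smul_mem _ _ (Submodule.subset_span (mem_saturatedSpan t))
  have hrn : r • n = ∑ t ∈ c.support, ρ (c t) • v t + r • y := by
    rw [← hc, Finsupp.sum, Finset.smul_sum, ← Finset.sum_add_distrib]
    refine Finset.sum_congr rfl fun t _ => ?_
    rw [← algebraMap_smul B (ρ (c t)), ← smul_assoc, ← add_smul, ← hb]
  have hsub : n - y ∈ saturatedSpan R v := mem_saturatedSpan_iff.mpr ⟨r, hr, by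
    rw [smul_sub, hrn, add_sub_cancel_right]
    exact sum_mem fun t _ => Submodule.smul_mem _ _ (Submodule.subset_span ⟨t, rfl⟩)⟩
  rw [← sub_add_cancel n y]
  exact add_mem (Submodule.subset_span hsub) hy

theorem isBaseChange_saturatedSpan [IsDomain R] [Module.Flat R B] [Module.IsTorsionFree R N]
    (hB : ∀ r : R, r ≠ 0 → ∀ b : B, ∃ (ρ : R) (b' : B), b = algebraMap R B ρ + r • b')
    (hv : LinearIndependent B v)
    (hspan : ∀ n, ∃ r : R, r ≠ 0 ∧ r • n ∈ Submodule.span B (Set.range v)) :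
    IsBaseChange B (saturatedSpan R v).subtype := by
  set f := (saturatedSpan R v).subtype.liftBaseChange B
  have hsurj : Function.Surjective f := by
    rw [← LinearMap.range_eq_top, eq_top_iff]
    rintro n -
    obtain ⟨r, hr, hn⟩ := hspan n
    refine Submodule.span_le.mpr ?_ (mem_span_saturatedSpan hr (hB r hr) hn)
    exact fun x hx => ⟨1 ⊗ₜ ⟨x, hx⟩, by simp [f]⟩
  exact IsBaseChange.of_equiv
    (LinearEquiv.ofBijective f ⟨injective_liftBaseChange_saturatedSpan hv, hsurj⟩)
    fun x => (by simp [f] : f (1 ⊗ₜ x) = x)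

end Lattice

theorem exists_isBaseChange_of_rank_eq {R : Type u} [CommRing R] [IsDomain R]
    [IsNoetherianRing R] [IsLocalRing R] [IsReduced (RHat R)] (hdim : ringKrullDim R = 1)
    {N : Type w'} [AddCommGroup N] [Module R N] [Module (RHat R) N] [IsScalarTower R (RHat R) N]
    [Module.IsTorsionFree R N] (hN : IsCountablyGenerated (RHat R) N)
    (hrank : ∀ P Q : minimalPrimes (RHat R),
      (Module.rank (Localization.AtPrime P.1) (Localization.AtPrime P.1 ⊗[RHat R] N)).toENat =
        (Module.rank (Localization.AtPrime Q.1) (Localization.AtPrime Q.1 ⊗[RHat R] N)).toENat) :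
    ∃ X : Submodule R N, IsCountablyGenerated R X ∧ IsBaseChange (RHat R) X.subtype := by
  have := isNoetherianRing_completion hdim
  obtain ⟨r, hrm, hr⟩ := exists_mem_maximalIdeal_ne_zero hdim
  obtain ⟨m, hm⟩ := exists_maximalIdeal_completion_pow_le hdim hr
  obtain ⟨κ, n, hn⟩ := exists_isBasisAt_of_rank_eq hN hrank
  obtain ⟨v, hv⟩ := exists_forall_isBasisAt hn
  have hspan : ∀ n, ∃ r : R, r ≠ 0 ∧ r • n ∈ Submodule.span (RHat R) (Set.range v) := by
    intro n
    obtain ⟨t, ht⟩ := exists_pow_mem_of_forall_not_le hm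
      (algebraMap_mem_maximalIdeal_completion hrm)
      (I := (Submodule.span (RHat R) (Set.range v)).comap (LinearMap.toSpanSingleton _ N n))
      fun P hP hle => by
        have : P.IsPrime := hP.1.1
        obtain ⟨b, hb, hbn⟩ := (hv ⟨P, hP⟩).exists_smul_mem_span n
        exact hb (hle hbn)
    rw [← map_pow, Submodule.mem_comap, LinearMap.toSpanSingleton_apply, algebraMap_smul] at ht
    exact ⟨r ^ t, pow_ne_zero t hr, ht⟩
  have hbase := isBaseChange_saturatedSpan (fun _ => exists_algebraMap_add_smul hdim)
    (linearIndependent_of_isBasisAt hv) hspan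
  exact ⟨_, isCountablyGenerated_of_isBaseChange hbase hN, hbase⟩

/-! ### Modules whose base change is a direct sum of retracts -/

/-- Every finite subset of `N` lies in a direct summand of `N`, the range of `b ∘ₗ a`, which is a
retract of a finite power of `Q`. -/
def IsLocallyRetract (A Q N : Type*) [Ring A] [AddCommGroup Q] [Module A Q] [AddCommGroup N]
    [Module A N] : Prop :=
  ∀ S : Finset N, ∃ (k : ℕ) (a : N →ₗ[A] (Fin k → Q)) (b : (Fin k → Q) →ₗ[A] N),
    b ∘ₗ a ∘ₗ b = b ∧ ∀ x ∈ S, b (a x) = x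

theorem isLocallyRetract_dfinsupp {A Q : Type*} [Ring A] [AddCommGroup Q] [Module A Q]
    {Λ : Type*} {Y : Λ → Type*} [∀ t, AddCommGroup (Y t)] [∀ t, Module A (Y t)]
    (h : ∀ t, IsRetract A (Y t) Q) : IsLocallyRetract A Q (Π₀ t, Y t) := by
  classical
  choose σ τ hτσ using h
  intro S
  obtain ⟨F, hF⟩ := exists_finset_forall_sum_single_eq S
  let t : Fin F.card ≃ F := F.equivFin.symm
  let a : (Π₀ t, Y t) →ₗ[A] (Fin F.card → Q) :=
    LinearMap.pi fun j => σ (t j) ∘ₗ DFinsupp.lapply (t j : Λ)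
  let b : (Fin F.card → Q) →ₗ[A] Π₀ t, Y t :=
    ∑ j, DFinsupp.lsingle (t j : Λ) ∘ₗ τ (t j) ∘ₗ LinearMap.proj j
  have hb (q : Fin F.card → Q) : b q = ∑ j, DFinsupp.single (t j : Λ) (τ (t j) (q j)) := by
    simp [b]
  have hba (x : Π₀ t, Y t) : b (a x) = ∑ i ∈ F, DFinsupp.single i (x i) := by
    rw [hb, ← Finset.sum_coe_sort F,
      ← t.sum_comp fun i : F => (DFinsupp.single (i : Λ) (x i) : Π₀ t, Y t)]
    exact Finset.sum_congr rfl fun j _ => congrArg _ (LinearMap.congr_fun (hτσ (t j)) _)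
  refine ⟨F.card, a, b, LinearMap.ext fun q => ?_, fun x hx => (hba x).trans (hF x hx)⟩
  change b (a (b q)) = b q
  have hbq (j : Fin F.card) : b q (t j : Λ) = τ (t j) (q j) := by
    rw [hb, DFinsupp.finsetSum_apply, Fintype.sum_eq_single j fun j' hj' =>
      DFinsupp.single_eq_of_ne fun h => hj' (t.injective (Subtype.ext h.symm)),
      DFinsupp.single_eq_same]
  rw [hba, ← Finset.sum_coe_sort F,
    ← t.sum_comp fun i : F => (DFinsupp.single (i : Λ) (b q i) : Π₀ t, Y t)]
  exact (Finset.sum_congr rfl fun j _ => by rw [hbq]).trans (hb q).symm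

theorem IsLocallyRetract.exists_of_fg {R B Q N X : Type*} [CommRing R] [CommRing B] [Algebra R B]
    [AddCommGroup Q] [Module B Q] [AddCommGroup N] [Module R N] [Module B N]
    [IsScalarTower R B N] [AddCommGroup X] [Module R X] (hN : IsLocallyRetract B Q N)
    (ε : X →ₗ[R] N) {A : Submodule R X} (hA : A.FG) :
    ∃ (k : ℕ) (a : N →ₗ[B] (Fin k → Q)) (b : (Fin k → Q) →ₗ[B] N),
      b ∘ₗ a ∘ₗ b = b ∧ ∀ x ∈ A, b (a (ε x)) = ε x := by
  classical
  obtain ⟨S, rfl⟩ := hA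
  obtain ⟨k, a, b, hbab, hba⟩ := hN (S.image ε)
  exact ⟨k, a, b, hbab, LinearMap.eqOn_span (f := (b ∘ₗ a).restrictScalars R ∘ₗ ε) (g := ε)
    fun x hx => hba _ (Finset.mem_image_of_mem ε hx)⟩

section Summand

variable {R : Type u} [CommRing R] [IsDomain R] [IsNoetherianRing R] [IsLocalRing R]
  [IsReduced (RHat R)] {M : Type v} [AddCommGroup M] [Module R M] [Module.Finite R M]

theorem exists_isRetract_finsupp_of_isLocallyRetract (hdim : ringKrullDim R = 1) {X N : Type*}
    [AddCommGroup X] [Module R X] [AddCommGroup N] [Module R N] [Module (RHat R) N]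
    [IsScalarTower R (RHat R) N] {ε : X →ₗ[R] N} (hε : IsBaseChange (RHat R) ε)
    (hX : IsCountablyGenerated R X) (hN : IsLocallyRetract (RHat R) (MHat R M) N) :
    ∃ k : ℕ → ℕ, IsRetract R X ((Σ n, Fin (k n)) →₀ M) := by
  have := isNoetherianRing_completion hdim
  obtain ⟨r, hrm, hr⟩ := exists_mem_maximalIdeal_ne_zero hdim
  obtain ⟨m, hm⟩ := exists_maximalIdeal_completion_pow_le hdim hr
  have hext : ∀ (k : ℕ) (A : Submodule R X), A.FG → ∃ t : ℕ, ∀ ψ : A →ₗ[R] (Fin k → MHat R M),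
      ∃ Ψ : N →ₗ[RHat R] (Fin k → MHat R M), ∀ x : A, Ψ (ε x) = r ^ t • ψ x := by
    intro k A hA
    obtain ⟨l, a, b, -, hba⟩ := hN.exists_of_fg ε hA
    exact exists_pow_smul_extension hm (algebraMap_mem_maximalIdeal_completion hrm) hε
      (ι := (LinearMap.range b).subtype) (κ := b.rangeRestrict ∘ₗ a) hba
  refine exists_isRetract_finsupp_of_locally_split hX fun S => ?_
  obtain ⟨k, a, b, hbab, hba⟩ := hN.exists_of_fg ε (Submodule.fg_span S.finite_toSet)
  have hγ := (TensorProduct.isBaseChange R M (RHat R)).finitePow (Fin k)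
  have hCa : b.rangeRestrict ∘ₗ a ∘ₗ (LinearMap.range b).subtype = LinearMap.id := by
    refine LinearMap.ext ?_
    rintro ⟨_, q, rfl⟩
    exact Subtype.ext (LinearMap.congr_fun hbab q)
  obtain ⟨s, hs⟩ := exists_approx_hom hγ hX
    (fun t => exists_algebraMap_add_smul hdim (pow_ne_zero t hr)) (hext k)
    ((a ∘ₗ (LinearMap.range b).subtype) ∘ₗ (b.rangeRestrict ∘ₗ a))
  obtain ⟨p, hp⟩ := exists_local_splitting hε (algebraMap_mem_jacobson_completion hrm)
    (ι := (LinearMap.range b).subtype) hCa hCa hs (Submodule.fg_span S.finite_toSet)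
    fun x hx => ⟨⟨ε x, a (ε x), hba x hx⟩, rfl⟩
  exact ⟨k, s, p, fun x hx => hp x (Submodule.subset_span hx)⟩

end Summand

/-! ### Ranks at the minimal primes -/

section Cardinality

variable {I : Type*} [Fintype I]

theorem toENat_mk_sigma (A : I → Type*) :
    Cardinal.toENat (Cardinal.mk (Σ i, A i)) = ∑ i, Cardinal.toENat (Cardinal.mk (A i)) := by
  change ENat.card (Σ i, A i) = ∑ i, ENat.card (A i)
  by_cases h : ∀ i, Finite (A i)
  · simp only [ENat.card_eq_coe_natCard, Nat.card_sigma, Nat.cast_sum]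
  · obtain ⟨i, hi⟩ := not_forall.mp h
    have := not_finite_iff_infinite.mp hi
    have : Infinite (Σ i, A i) := .of_injective (Sigma.mk i) sigma_mk_injective
    exact ENat.card_eq_top_of_infinite.trans <| Eq.symm <| ENat.sum_eq_top.mpr
      ⟨i, Finset.mem_univ _, ENat.card_eq_top_of_infinite⟩

theorem toENat_mk_sigma_fin {Λ : Type*} (c : Λ → I) (d : I → ℕ) :
    Cardinal.toENat (Cardinal.mk (Σ a, Fin (d (c a)))) =
      ∑ i, (d i : ℕ∞) * Cardinal.toENat (Cardinal.mk {a // c a = i}) := by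
  let e : (Σ a, Fin (d (c a))) ≃ Σ i, Σ _ : {a // c a = i}, Fin (d i) :=
    (Equiv.sigmaFiberEquiv c).sigmaCongrLeft.symm.trans <|
      (Equiv.sigmaCongrRight fun p => finCongr (congrArg d p.2.2)).trans
        (Equiv.sigmaAssoc fun i _ => Fin (d i))
  rw [Cardinal.toENat_congr e, toENat_mk_sigma]
  exact Finset.sum_congr rfl fun i _ => by simp [mul_comm]

theorem toENat_mk_lt (x : ℕ∞) : Cardinal.toENat (Cardinal.mk {k : ℕ // (k : ℕ∞) < x}) = x := by
  change ENat.card {k : ℕ // (k : ℕ∞) < x} = x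
  induction x using ENat.recTopCoe with
  | top =>
    rw [ENat.card_congr (Equiv.subtypeUnivEquiv ENat.natCast_lt_top)]
    exact ENat.card_eq_top_of_infinite
  | coe n =>
    rw [ENat.card_congr ((Equiv.subtypeEquivRight fun k => Nat.cast_lt).trans
      Fin.equivSubtype.symm)]
    simp

end Cardinality

section Rank

variable {B : Type*} [CommRing B] {K : Type w} [Field K] [Algebra B K]

theorem toENat_rank_tensorProduct_dfinsupp {I : Type*} [Fintype I] {L : I → Type*}
    [∀ i, AddCommGroup (L i)] [∀ i, Module B (L i)] [∀ i, Module.Finite B (L i)] {Λ : Type*}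
    (c : Λ → I) :
    (Module.rank K (K ⊗[B] (Π₀ a, L (c a)))).toENat =
      ∑ i, (Module.finrank K (K ⊗[B] L i) : ℕ∞) *
        Cardinal.toENat (Cardinal.mk {a // c a = i}) := by
  classical
  let b := DFinsupp.basis fun a => Module.finBasis K (K ⊗[B] L (c a))
  let e : (K ⊗[B] (Π₀ a, L (c a))) ≃ₗ[K] Π₀ a, K ⊗[B] L (c a) :=
    TensorProduct.directSumRight B K K fun a => L (c a)
  have h := congrArg Cardinal.toENat (b.map e.symm).mk_eq_rank
  rw [Cardinal.toENat_lift, Cardinal.toENat_lift] at h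
  rw [← h, toENat_mk_sigma_fin c fun i => Module.finrank K (K ⊗[B] L i)]

variable {X Y : Type*} [AddCommGroup X] [Module B X] [AddCommGroup Y] [Module B Y]

theorem toENat_rank_le_of_lTensor_injective {f : X →ₗ[B] Y}
    (hf : Function.Injective (f.lTensor K)) :
    (Module.rank K (K ⊗[B] X)).toENat ≤ (Module.rank K (K ⊗[B] Y)).toENat := by
  have h := Cardinal.toENat.monotone' (LinearMap.lift_rank_le_of_injective (f.baseChange K) hf)
  exact Cardinal.toENat_lift.symm.trans_le (h.trans_eq Cardinal.toENat_lift)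

theorem toENat_rank_eq_of_homTop_equiv {Q : Type*} [AddCommGroup Q] [Module B Q]
    [Module.Finite B Q] {ι κ : Type*} (hX : IsRetract B X (Π₀ _ : ι, Q))
    (hY : IsRetract B Y (Π₀ _ : κ, Q))
    (θ : HomTop B Q X ≃ₗ[(Module.End B Q)ᵐᵒᵖ] HomTop B Q Y) :
    (Module.rank K (K ⊗[B] X)).toENat = (Module.rank K (K ⊗[B] Y)).toENat := by
  obtain ⟨f, hf⟩ := exists_forall_lTensor_injective.{w} hX hY θ
  obtain ⟨g, hg⟩ := exists_forall_lTensor_injective.{w} hY hX θ.symm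
  exact le_antisymm (toENat_rank_le_of_lTensor_injective (hf K))
    (toENat_rank_le_of_lTensor_injective (hg K))

end Rank

section FlatBaseChange

variable {R B : Type*} [CommRing R] [IsDomain R] [CommRing B] [Algebra R B] [Module.Flat R B]
  {P : Ideal B} [P.IsPrime]

theorem algebraMap_localization_minimalPrimes_injective (hP : P ∈ minimalPrimes B) :
    Function.Injective (algebraMap R (Localization.AtPrime P)) := by
  refine (injective_iff_map_eq_zero _).mpr fun r hr => by_contra fun hr0 => ?_
  have hreg : IsSMulRegular B (algebraMap R B r) := (isSMulRegular_algebraMap_iff B).mpr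
    (Module.Flat.isSMulRegular_of_nonZeroDivisors (mem_nonZeroDivisors_of_ne_zero hr0))
  have hrP : algebraMap R B r ∉ P := hreg.notMem_of_mem_minimalPrimes <| by
    rwa [Module.annihilator_eq_bot.mpr inferInstance]
  rw [IsScalarTower.algebraMap_apply R B (Localization.AtPrime P)] at hr
  exact ((IsLocalization.AtPrime.isUnit_to_map_iff _ P _).mpr hrP).ne_zero hr

theorem toENat_rank_baseChange [IsReduced B] (hP : P ∈ minimalPrimes B) (X : Type*)
    [AddCommGroup X] [Module R X] :
    (Module.rank (Localization.AtPrime P) (Localization.AtPrime P ⊗[B] (B ⊗[R] X))).toENat =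
      (Module.rank R X).toENat := by
  let _ := (isField_localization_of_mem_minimalPrimes hP).toField
  have : FaithfulSMul R (Localization.AtPrime P) :=
    (faithfulSMul_iff_algebraMap_injective _ _).mpr
      (algebraMap_localization_minimalPrimes_injective hP)
  have h := congrArg Cardinal.toENat ((TensorProduct.isBaseChange R X B).comp
    (TensorProduct.isBaseChange B (B ⊗[R] X) (Localization.AtPrime P))).lift_rank_eq
  rwa [Cardinal.toENat_lift, Cardinal.toENat_lift] at h

end FlatBaseChange

theorem toENat_rank_localization_dfinsupp {B : Type u} [CommRing B] [IsReduced B] {I : Type*}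
    [Fintype I] {L : I → Type w} [∀ i, AddCommGroup (L i)] [∀ i, Module B (L i)]
    [∀ i, Module.Finite B (L i)] {P : Ideal B} [P.IsPrime] (hP : P ∈ minimalPrimes B)
    {Λ : Type*} (c : Λ → I) :
    (Module.rank (Localization.AtPrime P)
      (Localization.AtPrime P ⊗[B] (Π₀ a, L (c a)))).toENat =
      ∑ i, (rankAt P (L i) : ℕ∞) * Cardinal.toENat (Cardinal.mk {a // c a = i}) := by
  let _ := (isField_localization_of_mem_minimalPrimes hP).toField
  exact toENat_rank_tensorProduct_dfinsupp c

/-! ### The image of the dimension vector map -/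

section Modules

variable {A : Type*} [Ring A] {X Y : Type*} [AddCommGroup X] [Module A X] [AddCommGroup Y]
  [Module A Y]

theorem isCountablyGenerated_dfinsupp {Λ : Type*} [Countable Λ] {Y : Λ → Type*}
    [∀ a, AddCommGroup (Y a)] [∀ a, Module A (Y a)] [∀ a, Module.Finite A (Y a)] :
    IsCountablyGenerated A (Π₀ a, Y a) := by
  classical
  choose T hT using fun a => (Module.Finite.fg_top : (⊤ : Submodule A (Y a)).FG)
  refine ⟨⋃ a, DFinsupp.lsingle (R := A) (M := Y) a '' T a,
    Set.countable_iUnion fun a => (T a).countable_toSet.image _, ?_⟩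
  rw [Submodule.span_iUnion, ← DFinsupp.iSup_range_lsingle]
  exact iSup_congr fun a => by rw [Submodule.span_image, hT, Submodule.map_top]

theorem IsCountablyGenerated.of_linearEquiv (e : X ≃ₗ[A] Y) (h : IsCountablyGenerated A X) :
    IsCountablyGenerated A Y := by
  obtain ⟨t, ht, htop⟩ := h
  exact ⟨e.toLinearMap '' t, ht.image _, by
    rw [Submodule.span_image, htop, Submodule.map_top, LinearEquiv.range]⟩

theorem IsLocallyRetract.of_linearEquiv {Q : Type*} [AddCommGroup Q] [Module A Q] (e : X ≃ₗ[A] Y)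
    (h : IsLocallyRetract A Q X) : IsLocallyRetract A Q Y := by
  classical
  intro S
  obtain ⟨k, a, b, hbab, hba⟩ := h (S.image e.symm)
  refine ⟨k, a ∘ₗ e.symm.toLinearMap, e.toLinearMap ∘ₗ b, LinearMap.ext fun q => ?_,
    fun y hy => ?_⟩
  · simpa using LinearMap.congr_fun hbab q
  · simpa [LinearEquiv.symm_apply_eq] using congrArg e (hba _ (Finset.mem_image_of_mem e.symm hy))

theorem exists_sum_comp_eq_id {I : Type*} [Fintype I] {κ : I → Type*} [∀ i, Fintype (κ i)]
    {L : I → Type*} [∀ i, AddCommGroup (L i)] [∀ i, Module A (L i)]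
    (E : X ≃ₗ[A] ∀ i, κ i → L i) :
    ∃ (σ : ∀ k : Σ i, κ i, L k.1 →ₗ[A] X) (τ : ∀ k : Σ i, κ i, X →ₗ[A] L k.1),
      (∀ k, τ k ∘ₗ σ k = LinearMap.id) ∧ ∑ k, σ k ∘ₗ τ k = LinearMap.id := by
  classical
  let E' : X ≃ₗ[A] ∀ k : Σ i, κ i, L k.1 :=
    E.trans (LinearEquiv.piCurry A fun i (_ : κ i) => L i).symm
  refine ⟨fun k => E'.symm.toLinearMap ∘ₗ LinearMap.single A (fun k : Σ i, κ i => L k.1) k,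
    fun k => LinearMap.proj k ∘ₗ E'.toLinearMap, fun k => ?_, ?_⟩
  · exact LinearMap.ext fun y => by simp
  · refine LinearMap.ext fun x => E'.injective ?_
    rw [LinearMap.sum_apply, map_sum]
    simpa using Finset.univ_sum_single (E' x)

theorem isTorsionFree_dfinsupp {Λ : Type*} {Y : Λ → Type*} [∀ a, AddCommGroup (Y a)]
    [∀ a, Module A (Y a)] [∀ a, Module.IsTorsionFree A (Y a)] :
    Module.IsTorsionFree A (Π₀ a, Y a) :=
  DFunLike.coe_injective.moduleIsTorsionFree (fun f : Π₀ a, Y a => (f : ∀ a, Y a))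
    fun _ _ => rfl

end Modules

section Retracts

variable {R : Type*} [CommRing R] {X : Type*} [AddCommGroup X] [Module R X]

theorem IsRetract.isTorsionFree {B Q : Type*} [CommRing B] [Algebra R B] [AddCommGroup Q]
    [Module R Q] [Module B Q] [IsScalarTower R B Q] [Module B X] [IsScalarTower R B X]
    [Module.IsTorsionFree R Q] (h : IsRetract B X Q) : Module.IsTorsionFree R X := by
  obtain ⟨e, p, hpe⟩ := h
  have he : Function.Injective e := Function.LeftInverse.injective (LinearMap.congr_fun hpe)
  exact he.moduleIsTorsionFree e (e.restrictScalars R).map_smul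

theorem IsRetract.baseChange (B : Type*) [CommRing B] [Algebra R B] {M : Type*} [AddCommGroup M]
    [Module R M] {ι : Type*} (h : IsRetract R X (ι →₀ M)) :
    IsRetract B (B ⊗[R] X) (Π₀ _ : ι, B ⊗[R] M) := by
  classical
  obtain ⟨e, p, hpe⟩ := h
  refine .trans ⟨e.baseChange B, p.baseChange B, ?_⟩ <| .of_linearEquiv <|
    (TensorProduct.finsuppRight R B B M ι).trans (finsuppLequivDFinsupp B)
  rw [← LinearMap.baseChange_comp, hpe, LinearMap.baseChange_id]

theorem IsRetract.exists_inAdd {M : Type v} [AddCommGroup M] [Module R M] {ι : Type}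
    (h : IsRetract R X (ι →₀ M)) :
    ∃ X' : Submodule R (ι →₀ M), InAdd R M X' ∧ Nonempty (X ≃ₗ[R] X') := by
  obtain ⟨e, p, hpe⟩ := h
  let E := LinearEquiv.ofInjective e (Function.LeftInverse.injective (LinearMap.congr_fun hpe))
  obtain ⟨e', p', hpe'⟩ := (IsRetract.of_linearEquiv E.symm).trans <|
    .trans ⟨e, p, hpe⟩ (.of_linearEquiv (Finsupp.domLCongr (M := M) (R := R) Equiv.ulift.{v}.symm))
  exact ⟨_, ⟨ULift.{v} ι, e', p', hpe'⟩, ⟨E⟩⟩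

end Retracts

section Main

variable {R : Type u} [CommRing R] [IsDomain R] [IsNoetherianRing R] [IsLocalRing R]
  [IsReduced (RHat R)] {M : Type v} [AddCommGroup M] [Module R M] {s : ℕ}
  {L : Fin s → Type w} [∀ i, AddCommGroup (L i)] [∀ i, Module (RHat R) (L i)]
  [∀ i, Module.Finite (RHat R) (L i)]

theorem exists_baseChange_linearEquiv_dfinsupp (hdim : ringKrullDim R = 1)
    [Module.IsTorsionFree R M] (hL : ∀ i, IsRetract (RHat R) (L i) (MHat R M))
    {Λ : Type} [Countable Λ] (c : Λ → Fin s)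
    (hc : ∀ P Q : minimalPrimes (RHat R),
      ∑ i, (rankAt P.1 (L i) : ℕ∞) * Cardinal.toENat (Cardinal.mk {a // c a = i}) =
        ∑ i, (rankAt Q.1 (L i) : ℕ∞) * Cardinal.toENat (Cardinal.mk {a // c a = i})) :
    ∃ (X : Type w) (_ : AddCommGroup X) (_ : Module R X),
      IsCountablyGenerated R X ∧ Nonempty (RHat R ⊗[R] X ≃ₗ[RHat R] Π₀ a, L (c a)) := by
  let _ : ∀ i, Module R (L i) := fun i => Module.compHom (L i) (algebraMap R (RHat R))
  have : ∀ i, IsScalarTower R (RHat R) (L i) := fun _ => .of_algebraMap_smul fun _ _ => rfl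
  have := isTorsionFree_tensorProduct (R := R) (B := RHat R) M
  have : ∀ i, Module.IsTorsionFree R (L i) := fun i => (hL i).isTorsionFree
  have := isTorsionFree_dfinsupp (A := R) (Y := fun a => L (c a))
  obtain ⟨X, hX, hXb⟩ := exists_isBaseChange_of_rank_eq (R := R) hdim
    (isCountablyGenerated_dfinsupp (A := RHat R) (Y := fun a => L (c a))) fun P Q => by
      rw [toENat_rank_localization_dfinsupp P.2, toENat_rank_localization_dfinsupp Q.2, hc]
  exact ⟨X, _, _, hX, ⟨hXb.equiv⟩⟩

variable [Module.Finite R M]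

theorem sum_rankAt_mul_dimVec (hdim : ringKrullDim R = 1)
    [∀ i, IsLocalRing (Module.End (RHat R) (L i))]
    (hpair : ∀ i j, i ≠ j → IsEmpty (L i ≃ₗ[RHat R] L j))
    (hL : ∀ i, IsRetract (RHat R) (L i) (MHat R M)) {κ : Type*} [Fintype κ] (col : κ → Fin s)
    (σ : ∀ k, L (col k) →ₗ[RHat R] MHat R M) (τ : ∀ k, MHat R M →ₗ[RHat R] L (col k))
    (hστ : ∑ k, σ k ∘ₗ τ k = LinearMap.id) {X : Type v} [AddCommGroup X] [Module R X]
    (hX : InAdd R M X) {P : Ideal (RHat R)} [P.IsPrime] (hP : P ∈ minimalPrimes (RHat R)) :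
    ∑ i, (rankAt P (L i) : ℕ∞) * dimVec R M L X i = (Module.rank R X).toENat := by
  obtain ⟨S, c, ⟨θ⟩⟩ := exists_homTop_linearEquiv_dfinsupp (fun i => isSimpleModule_homTop (hL i))
    col σ τ hστ (RHat R ⊗[R] X)
  obtain ⟨E⟩ := nonempty_homTop_linearEquiv (M := M) (X := X) hdim
  obtain ⟨φ⟩ := nonempty_homTop_dfinsupp (A := RHat R) (Q := MHat R M) (Y := fun a => L (c a))
  obtain ⟨ι, hXι⟩ := hX
  let _ := (isField_localization_of_mem_minimalPrimes hP).toField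
  simp only [dimVec_eq_toENat_mk (endDense_of_finite hdim) hL hpair E θ]
  rw [← toENat_rank_baseChange hP X, ← toENat_rank_localization_dfinsupp hP c]
  exact (toENat_rank_eq_of_homTop_equiv (IsRetract.baseChange (RHat R) hXι)
    (.dfinsupp fun a => hL (c a)) (θ.trans φ.symm)).symm

theorem exists_dimVec_eq (hdim : ringKrullDim R = 1) [Module.IsTorsionFree R M]
    [∀ i, IsLocalRing (Module.End (RHat R) (L i))]
    (hpair : ∀ i j, i ≠ j → IsEmpty (L i ≃ₗ[RHat R] L j))
    (hL : ∀ i, IsRetract (RHat R) (L i) (MHat R M)) {x : Fin s → ℕ∞}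
    (hx : ∀ P Q : minimalPrimes (RHat R),
      ∑ i, (rankAt P.1 (L i) : ℕ∞) * x i = ∑ i, (rankAt Q.1 (L i) : ℕ∞) * x i) :
    ∃ X : ModuleCat.{v} R, IsCountablyGenerated R X ∧ InAdd R M X ∧ dimVec R M L X = x := by
  let c : (Σ i, {k : ℕ // (k : ℕ∞) < x i}) → Fin s := Sigma.fst
  have hc (i) : Cardinal.toENat (Cardinal.mk {a // c a = i}) = x i :=
    (Cardinal.toENat_congr (Equiv.sigmaSubtype i)).trans (toENat_mk_lt (x i))
  obtain ⟨X, _, _, hX, ⟨E⟩⟩ := exists_baseChange_linearEquiv_dfinsupp hdim hL c <| by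
    simpa only [hc] using hx
  obtain ⟨k, hXk⟩ := exists_isRetract_finsupp_of_isLocallyRetract (M := M) hdim
    (TensorProduct.isBaseChange R X (RHat R)) hX <|
      (isLocallyRetract_dfinsupp fun a => hL (c a)).of_linearEquiv E.symm
  obtain ⟨X', hX', ⟨e⟩⟩ := hXk.exists_inAdd
  obtain ⟨θ⟩ := nonempty_homTop_linearEquiv (M := M) (X := X') hdim
  obtain ⟨φ⟩ := nonempty_homTop_dfinsupp (A := RHat R) (Q := MHat R M) (Y := fun a => L (c a))
  refine ⟨.of R X', hX.of_linearEquiv e, hX', funext fun i => (Eq.trans ?_ (hc i))⟩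
  exact dimVec_eq_toENat_mk (endDense_of_finite hdim) hL hpair θ
    ((homTopCongr ((e.symm.baseChange R (RHat R) _ _).trans E)).trans φ) i

end Main

end LocalAdd

end

theorem mainTheorem6 {R : Type u} [CommRing R] [IsDomain R] [IsNoetherianRing R] [IsLocalRing R]
    (hdim : ringKrullDim R = 1) (hred : IsReduced (LocalAdd.RHat R))
    {M : Type v} [AddCommGroup M] [Module R M] [Module.Finite R M] [Module.IsTorsionFree R M]
    {s : ℕ} (L : Fin s → Type w) [∀ i, AddCommGroup (L i)] [∀ i, Module (LocalAdd.RHat R) (L i)]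
    (hindec : ∀ i, LocalAdd.IsIndecomposable (LocalAdd.RHat R) (L i))
    (hnoniso : ∀ i j, i ≠ j → IsEmpty (L i ≃ₗ[LocalAdd.RHat R] L j))
    (n : Fin s → ℕ) (hn : ∀ i, 0 < n i)
    (hdecomp : Nonempty
      (LocalAdd.MHat R M ≃ₗ[LocalAdd.RHat R] ((i : Fin s) → Fin (n i) → L i)))
    (x : Fin s → ℕ∞) :
    x ∈ Set.range (LocalAdd.DMap R M L) ↔
      ∀ (P Q : Ideal (LocalAdd.RHat R)) [P.IsPrime] [Q.IsPrime],
        P ∈ minimalPrimes (LocalAdd.RHat R) → Q ∈ minimalPrimes (LocalAdd.RHat R) →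
          ∑ i, (LocalAdd.rankAt P (L i) : ℕ∞) * x i =
            ∑ i, (LocalAdd.rankAt Q (L i) : ℕ∞) * x i := by
  obtain ⟨E⟩ := hdecomp
  obtain ⟨σ, τ, hτσ, hστ⟩ := LocalAdd.exists_sum_comp_eq_id E
  have hL (i : Fin s) : LocalAdd.IsRetract (LocalAdd.RHat R) (L i) (LocalAdd.MHat R M) :=
    ⟨_, _, hτσ ⟨i, 0, hn i⟩⟩
  have hnoeth := LocalAdd.isNoetherianRing_completion hdim
  have hfin (i : Fin s) := (hL i).finite
  have hlocal (i : Fin s) := (hindec i).isLocalRing_end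
  constructor
  · rintro ⟨X, rfl⟩ P Q _ _ hP hQ
    obtain ⟨⟨X, -, hX⟩, rfl⟩ := Quotient.exists_rep X
    exact (LocalAdd.sum_rankAt_mul_dimVec hdim hnoniso hL Sigma.fst σ τ hστ hX hP).trans
      (LocalAdd.sum_rankAt_mul_dimVec hdim hnoniso hL Sigma.fst σ τ hστ hX hQ).symm
  · intro hx
    obtain ⟨X, hXc, hXa, hXx⟩ :=
      LocalAdd.exists_dimVec_eq hdim hnoniso hL fun P Q => hx P.1 Q.1 P.2 Q.2
    exact ⟨Quotient.mk _ ⟨X, hXc, hXa⟩, hXx⟩
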